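/- **Setting.** Let $\mathbb H$ be the real quaternions and $\mathcal H=\{h+\varepsilon h' : h,h'\in\mathbb H\}$, $\varepsilon^2=0$, the dual quaternions, with conjugation $(h+\varepsilon h')^*=h^*+\varepsilon h'^*$. A unit dual quaternion is an $x\in\mathcal H$ with $xx^*=1$; equivalently $x=r+\varepsilon\tfrac12 p\,r$ with $r$ a unit quaternion (rotation) and $p$ a pure quaternion (translation). Let $\mathrm{vec}_3,\mathrm{vec}_4,\mathrm{vec}_6,\mathrm{vec}_8$ be the coefficient vectors of pure quaternions, quaternions, pure dual quaternions and dual quaternions. Let $\overset{+}{H}_4,\overset{-}{H}_4,\overset{-}{H}_8$ be the Hamilton matrices, characterized by $\mathrm{vec}_4(ab)=\overset{+}{H}_4(a)\mathrm{vec}_4 b=\overset{-}{H}_4(b)\mathrm{vec}_4 a$ and $\mathrm{vec}_8(ab)=\overset{-}{H}_8(b)\mathrm{vec}_8 a$. A unit quaternion $r\neq-1$ is $r=\cos(\phi/2)+\sin(\phi/2)\,n$ with $\phi\in[0,2\pi)$ and $n$ a pure unit quaternion, and $\log r=(\phi/2)n$. For a unit dual quaternion $x=r+\varepsilon\tfrac12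 pr$ with $r\ne-1$ put $\log x=\log r+\varepsilon\tfrac12 p$ and $$Q_8(x)=\begin{bmatrix}Q(r)&0\\ \tfrac12\overset{+}{H}_4(p)Q(r)&\overset{-}{H}_4(r)Q_p\end{bmatrix},\qquad Q(r)=\frac{\partial\,\mathrm{vec}_4 r}{\partial\,\mathrm{vec}_3 y},\ y=\log r,\qquad Q_p=\begin{bmatrix}0_{1\times3}\\ I_3\end{bmatrix},$$ where $Q(r)$ is the Jacobian at $y=\log r$ of the exponential map $y\mapsto\cos\|y\|+\frac{\sin\|y\|}{\|y\|}y$ on pure quaternions. Let $n\ge1$ and let $\mathcal G$ be a simple weighted directed graph on $n$ vertices, with weights $a_{ij}>0$ if there is an edge from $j$ (parent) to $i$ (child) and $a_{ij}=0$ otherwise (in particular $a_{ii}=0$). A directed spanning tree of $\mathcal G$ is a subgraph on all the vertices in which exactly one vertex, the root, has no parent, every other vertex has exactly one parent, and there is a directed path from the root to every vertex. Consider $n$ agents with poses $x_i(t)$, $t\ge0$, that are unit dual quaternions, and let $\delta_i$ be constant unit dual quaternions (the desired poses relative to the center of formation). Put $x_{c,i}=x_i\delta_i^*$ and $y_{c,i}=\log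 x_{c,i}$. Let the agents obey the kinematics $\dot x_i=\tfrac12\xi_i x_i$ with the twist $\xi_i$ as control input, given by $$\mathrm{vec}_8\,\xi_i=-2\,\overset{-}{H}_8(x_i^*)\,\overset{-}{H}_8(\delta_i)\,Q_8(x_{c,i})\sum_{j=1}^n a_{ij}\,\mathrm{vec}_6(y_{c,i}-y_{c,j}),\qquad i=1,\dots,n .$$ Call initial poses admissible if every $x_{c,i}(0)$ has rotation different from $-1$, so that $y_{c,i}(0)$ is defined. **Statement.** For every such $n$, $\mathcal G$ and $\delta_1,\dots,\delta_n$: 1. For all admissible initial poses the closed-loop system has a solution on $[0,\infty)$, with twists $\xi_i(t)$ that are pure dual quaternions. 2. The agents achieve output consensus on the center of formation, that is, $\lim_{t\to\infty}(y_{c,i}(t)-y_{c,j}(t))=0$ for all $i,j$ and for every closed-loop solution with admissible initial poses, if and only if $\mathcal G$ has a directed spanning tree. 3. The agents achieve the formation, that is, for every closed-loop solution with admissible initial poses there is a unit dual quaternion $x_c$ with $\lim_{t\to\infty}x_i(t)=x_c\delta_i$ for all $i$, if and only if $\mathcal G$ has a directed spanning tree. -/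

import Mathlib

open scoped Quaternion Topology

noncomputable section

namespace PoseFormation

/-! ### Weighted digraphs and directed spanning trees -/

/-- A simple weighted directed graph on the vertices `Fin n`. `Adj u v` is the edge with parent
(tail) `u` and child (head) `v`; the weight `A i j` belongs to the edge with parent `j` and
child `i`. -/
structure WeightedDigraph (n : ℕ) extends Digraph (Fin n) where
  loopless : ∀ i, ¬ Adj i i
  A : Matrix (Fin n) (Fin n) ℝ
  A_pos : ∀ i j, Adj j i → 0 < A i j
  A_zero : ∀ i j, ¬ Adj j i → A i j = 0

/-- A directed tree: only the root has no parent, every other vertex has exactly one parent, and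
there is a path from the root to every vertex. -/
def IsDirectedTree {V : Type*} (T : Digraph V) : Prop :=
  ∃ root : V, (∀ u, ¬ T.Adj u root) ∧ (∀ v, v ≠ root → ∃! u, T.Adj u v) ∧
    ∀ v, Relation.ReflTransGen T.Adj root v

/-- Some edges can be removed, keeping all vertices, so that a directed tree remains. -/
def HasDirectedSpanningTree {V : Type*} (G : Digraph V) : Prop :=
  ∃ T : Digraph V, T ≤ G ∧ IsDirectedTree T

/-! ### Quaternions -/

/-- The coefficient vector of a quaternion. -/
def vec4 (h : ℍ[ℝ]) : Fin 4 → ℝ := ![h.re, h.imI, h.imJ, h.imK]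

/-- The coefficient vector of a pure quaternion. -/
def vec3 (h : ℍ[ℝ]) : Fin 3 → ℝ := ![h.imI, h.imJ, h.imK]

/-- The pure quaternion with a given coefficient vector. -/
def pureOfVec3 (v : Fin 3 → ℝ) : ℍ[ℝ] := ⟨0, v 0, v 1, v 2⟩

/-- Hamilton operator: `vec4 (a * b) = hamiltonPlus4 a *ᵥ vec4 b`. -/
def hamiltonPlus4 (h : ℍ[ℝ]) : Matrix (Fin 4) (Fin 4) ℝ :=
  !![h.re, -h.imI, -h.imJ, -h.imK;
     h.imI, h.re, -h.imK, h.imJ;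
     h.imJ, h.imK, h.re, -h.imI;
     h.imK, -h.imJ, h.imI, h.re]

/-- Hamilton operator: `vec4 (a * b) = hamiltonMinus4 b *ᵥ vec4 a`. -/
def hamiltonMinus4 (h : ℍ[ℝ]) : Matrix (Fin 4) (Fin 4) ℝ :=
  !![h.re, -h.imI, -h.imJ, -h.imK;
     h.imI, h.re, h.imK, -h.imJ;
     h.imJ, -h.imK, h.re, h.imI;
     h.imK, h.imJ, -h.imI, h.re]

/-- The half angle `φ / 2 ∈ [0, π]` of a unit quaternion `r = cos (φ / 2) + sin (φ / 2) n`. -/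
def halfAngle (r : ℍ[ℝ]) : ℝ := Real.arccos r.re

/-- The rotation axis `n` of a unit quaternion `r = cos (φ / 2) + sin (φ / 2) n` with
`0 < φ < 2 π`; it is irrelevant, and set to `0`, for `r = 1`. -/
def axis (r : ℍ[ℝ]) : ℍ[ℝ] := ‖r.im‖⁻¹ • r.im

/-- The logarithm `(φ / 2) n` of a unit quaternion `r = cos (φ / 2) + sin (φ / 2) n` with
`φ ∈ [0, 2 π)`. These `r` are the unit quaternions other than `-1`, where the value below is
meaningless. -/
def logQuat (r : ℍ[ℝ]) : ℍ[ℝ] := halfAngle r • axis r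

/-- The Jacobian matrix `∂ vec4 r / ∂ vec3 y`, where `y = log r`, that is, the derivative at
`log r` of the exponential map on pure quaternions,
`y ↦ cos ‖y‖ + (sin ‖y‖ / ‖y‖) y`, in coordinates. -/
def Q (r : ℍ[ℝ]) : Matrix (Fin 4) (Fin 3) ℝ :=
  LinearMap.toMatrix' (fderiv ℝ (fun v : Fin 3 → ℝ => vec4 (NormedSpace.exp (pureOfVec3 v)))
    (vec3 (logQuat r))).toLinearMap

/-- The matrix with zero first row and the identity below it. -/
def Qp : Matrix (Fin 4) (Fin 3) ℝ :=
  !![0, 0, 0;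
     1, 0, 0;
     0, 1, 0;
     0, 0, 1]

/-! ### Dual quaternions

`h + ε h'` is the dual number with `fst = h` and `snd = h'`. The topology on `DualQuat` is that of
`ℍ × ℍ`. Vectors in `ℝ⁸` and `ℝ⁶` are indexed by `Fin 4 ⊕ Fin 4` and `Fin 3 ⊕ Fin 3`, the first
summand for the primary part and the second one for the dual part. -/

abbrev DualQuat : Type := DualNumber ℍ[ℝ]

/-- `h + ε h'`. -/
def mkDQ (h h' : ℍ[ℝ]) : DualQuat := TrivSqZeroExt.inl h + TrivSqZeroExt.inr h'

/-- The conjugate `Re h - Im h`. -/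
def conj (h : DualQuat) : DualQuat := mkDQ (star h.fst) (star h.snd)

/-- Unit dual quaternions: `‖h‖ = √(h h*) = 1`. -/
def IsUnitDQ (h : DualQuat) : Prop := h * conj h = 1

/-- Pure dual quaternions: `Re h = 0`. -/
def IsPureDQ (h : DualQuat) : Prop := h.fst.re = 0 ∧ h.snd.re = 0

def vec8 (h : DualQuat) : Fin 4 ⊕ Fin 4 → ℝ := Sum.elim (vec4 h.fst) (vec4 h.snd)

def vec6 (h : DualQuat) : Fin 3 ⊕ Fin 3 → ℝ := Sum.elim (vec3 h.fst) (vec3 h.snd)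

/-- Hamilton operator: `vec8 (a * b) = hamiltonMinus8 b *ᵥ vec8 a`. -/
def hamiltonMinus8 (h : DualQuat) : Matrix (Fin 4 ⊕ Fin 4) (Fin 4 ⊕ Fin 4) ℝ :=
  Matrix.fromBlocks (hamiltonMinus4 h.fst) 0 (hamiltonMinus4 h.snd) (hamiltonMinus4 h.fst)

/-- The rotation `r` of a unit dual quaternion `r + ε (1/2) p r`. -/
def rotation (x : DualQuat) : ℍ[ℝ] := x.fst

/-- The translation `p` of a unit dual quaternion `r + ε (1/2) p r`. -/
def translation (x : DualQuat) : ℍ[ℝ] := (2 : ℝ) • (x.snd * star x.fst)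

/-- The logarithm `log r + ε (1/2) p` of a unit dual quaternion `r + ε (1/2) p r`. -/
def logDQ (x : DualQuat) : DualQuat :=
  mkDQ (logQuat (rotation x)) ((1 / 2 : ℝ) • translation x)

/-- The unit dual quaternions that have a logarithm: those with rotation
`cos (φ / 2) + sin (φ / 2) n`, `φ ∈ [0, 2 π)`, that is, with rotation other than `-1`. -/
def InLogDomain (x : DualQuat) : Prop := IsUnitDQ x ∧ rotation x ≠ -1

/-- The matrix `Q₈` of the differential logarithmic mapping,
`vec8 ẋ = Q₈(x) vec6 ẏ` for `y = log x`. -/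
def Q8 (x : DualQuat) : Matrix (Fin 4 ⊕ Fin 4) (Fin 3 ⊕ Fin 3) ℝ :=
  Matrix.fromBlocks (Q (rotation x)) 0
    ((1 / 2 : ℝ) • (hamiltonPlus4 (translation x) * Q (rotation x)))
    (hamiltonMinus4 (rotation x) * Qp)

/-! ### The multi-agent system -/

/-- The opinion `x_c = x δ*` on the center of formation of an agent with pose `x` and desired
relative pose `δ`. -/
def center (x δ : DualQuat) : DualQuat := x * conj δ

/-- The output `y_c = log x_c` of an agent. -/
def output (x δ : DualQuat) : DualQuat := logDQ (center x δ)

/-- The value of `vec8 ξ_i` prescribed by the consensus protocol when the agents have poses `x`. -/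
def formationProtocol {n : ℕ} (G : WeightedDigraph n) (δ x : Fin n → DualQuat) (i : Fin n) :
    Fin 4 ⊕ Fin 4 → ℝ :=
  (-2 : ℝ) • (hamiltonMinus8 (conj (x i)) * hamiltonMinus8 (δ i) * Q8 (center (x i) (δ i))).mulVec
    (∑ j, G.A i j • vec6 (output (x i) (δ i) - output (x j) (δ j)))

/-- `x` and `ξ` are the poses and the twists of the agents on `[0, ∞)` under the protocol. -/
structure IsClosedLoop {n : ℕ} (G : WeightedDigraph n) (δ : Fin n → DualQuat)
    (x ξ : Fin n → ℝ → DualQuat) : Prop where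
  unit : ∀ i t, 0 ≤ t → IsUnitDQ (x i t)
  kinematics : ∀ i t, 0 ≤ t →
    HasDerivWithinAt (x i) ((1 / 2 : ℝ) • (ξ i t * x i t)) (Set.Ici 0) t
  protocol : ∀ i t, 0 ≤ t → vec8 (ξ i t) = formationProtocol G δ (fun j => x j t) i

/-- The initial poses for which all the initial outputs are defined. -/
def IsAdmissible {n : ℕ} (δ x₀ : Fin n → DualQuat) : Prop :=
  ∀ i, IsUnitDQ (x₀ i) ∧ InLogDomain (center (x₀ i) (δ i))

/-- Output consensus on the center of formation, from all admissible initial poses. -/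
def AchievesOutputConsensus {n : ℕ} (G : WeightedDigraph n) (δ : Fin n → DualQuat) : Prop :=
  ∀ x ξ : Fin n → ℝ → DualQuat, IsClosedLoop G δ x ξ → IsAdmissible δ (fun i => x i 0) →
    ∀ i j, Filter.Tendsto (fun t => output (x i t) (δ i) - output (x j t) (δ j))
      Filter.atTop (𝓝 0)

/-- Convergence of the poses to the desired formation around some common center `x_c`, from all
admissible initial poses. -/
def AchievesFormation {n : ℕ} (G : WeightedDigraph n) (δ : Fin n → DualQuat) : Prop :=
  ∀ x ξ : Fin n → ℝ → DualQuat, IsClosedLoop G δ x ξ → IsAdmissible δ (fun i => x i 0) →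
    ∃ xc : DualQuat, IsUnitDQ xc ∧
      ∀ i, Filter.Tendsto (x i) Filter.atTop (𝓝 (xc * δ i))

end PoseFormation

end

noncomputable section

namespace PoseFormation

/-! ### Linear consensus -/

section Consensus

open scoped Matrix.Norms.Operator

variable {V : Type*} [Fintype V] [DecidableEq V]

/-! The protocol is a feedback linearization. The Hamilton matrices encode right multiplications, so
the prescribed twist is `-2 v δ x*`, where `v` is the dual quaternion with coefficients `Q₈ ∑ a_ij
(y_i - y_j)`. The factors `x*` and `δ` cancel and the center obeys `ẋ_c = -v`
(`IsClosedLoop.hasDerivWithinAt_center`). Since `Q₈` is the differential of the exponential in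
logarithmic coordinates, the outputs satisfy the linear consensus equation `ẏ = -L y` in both the
rotation and the translation component (`IsClosedLoop.hasDerivWithinAt_output`), so `y(t) = e^{-tL}
y(0)`.

This holds only while no center has rotation `-1`. For nonnegative weights `e^{-tL}` is row
stochastic when `t ≥ 0`, so the rotational outputs stay in a ball of radius `R < π` fixed by the
initial data. A first-exit-time argument then shows that the singular rotation is never reached
(`IsClosedLoop.center_fst_ne`). Conversely, exponentiating the linear flow gives a closed-loop
solution (`exists_isClosedLoop`).

If some vertex reaches all others, its column of `e^{-L}` is bounded below by some `ε > 0`. Each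
unit of time therefore contracts the range of values by `1 - ε`, and all agents tend to one limit
(`exists_tendsto_consensusFlow`); continuity of the exponential turns this into convergence of the
poses. Without a spanning tree there are two disjoint vertex sets that no edge enters. With trivial
rotations and different translations on the two sets, an agent in each stays at rest, which refutes
both consensus and formation. -/

/-- The Laplacian of a weight matrix. -/
def laplacian (A : Matrix V V ℝ) : Matrix V V ℝ := Matrix.diagonal (fun i => ∑ j, A i j) - A

/-- The flow of the linear consensus dynamics. -/
def consensusFlow (A : Matrix V V ℝ) (t : ℝ) : Matrix V V ℝ :=
  NormedSpace.exp (t • (-laplacian A))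

theorem sum_laplacian_smul {E : Type*} [AddCommGroup E] [Module ℝ E] (A : Matrix V V ℝ)
    (y : V → E) (i : V) : ∑ j, laplacian A i j • y j = ∑ j, A i j • (y i - y j) := by
  simp [laplacian, Matrix.diagonal_apply, sub_smul, smul_sub, Finset.sum_sub_distrib,
    Finset.sum_smul, ite_smul]

theorem hasDerivAt_consensusFlow (A : Matrix V V ℝ) (t : ℝ) (i j : V) :
    HasDerivAt (fun u => consensusFlow A u i j) (-(consensusFlow A t * laplacian A) i j) t := by
  have h := hasDerivAt_exp_smul_const (𝕂 := ℝ) (-laplacian A) t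
  have h' : HasDerivAt (fun u => consensusFlow A u i j)
      ((consensusFlow A t * -laplacian A) i j) t := hasDerivAt_pi.1 (hasDerivAt_pi.1 h i) j
  rwa [mul_neg] at h'

theorem hasDerivAt_consensusFlow' (A : Matrix V V ℝ) (t : ℝ) (i j : V) :
    HasDerivAt (fun u => consensusFlow A u i j) (-(laplacian A * consensusFlow A t) i j) t := by
  have h := hasDerivAt_exp_smul_const' (𝕂 := ℝ) (-laplacian A) t
  have h' : HasDerivAt (fun u => consensusFlow A u i j)
      ((-laplacian A * consensusFlow A t) i j) t := hasDerivAt_pi.1 (hasDerivAt_pi.1 h i) j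
  rwa [neg_mul] at h'

theorem consensusFlow_zero (A : Matrix V V ℝ) : consensusFlow A 0 = 1 := by
  simp [consensusFlow]

theorem consensusFlow_add (A : Matrix V V ℝ) (s t : ℝ) :
    consensusFlow A (s + t) = consensusFlow A s * consensusFlow A t := by
  rw [consensusFlow, add_smul]
  exact Matrix.exp_add_of_commute _ _ (((Commute.refl _).smul_left _).smul_right _)

/-- Uniqueness for the linear system: `u ↦ e^{-(t-u)L} y(u)` has zero derivative on `[0, t]`, and
its values at the endpoints are the two sides. The time interval is half-open because closed loops
are first controlled only before a possible exit time. -/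
theorem eq_consensusFlow_of_hasDerivWithinAt {E : Type*} [NormedAddCommGroup E] [NormedSpace ℝ E]
    (A : Matrix V V ℝ) (y : V → ℝ → E) {T : ℝ}
    (hy : ∀ t ∈ Set.Ico 0 T, ∀ i,
      HasDerivWithinAt (y i) (-∑ j, A i j • (y i t - y j t)) (Set.Ici 0) t)
    {t : ℝ} (ht : t ∈ Set.Ico 0 T) (i : V) : y i t = ∑ j, consensusFlow A t i j • y j 0 := by
  have hd : ∀ u ∈ Set.Icc 0 t, HasDerivWithinAt
      (fun u => ∑ j, consensusFlow A (t - u) i j • y j u) 0 (Set.Ici 0) u := by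
    intro u hu
    have h1 : ∀ j, HasDerivWithinAt (fun u => consensusFlow A (t - u) i j • y j u)
        (consensusFlow A (t - u) i j • (-∑ k, laplacian A j k • y k u)
          + (consensusFlow A (t - u) * laplacian A) i j • y j u) (Set.Ici 0) u := by
      intro j
      have hP : HasDerivWithinAt (fun u => consensusFlow A (t - u) i j)
          ((consensusFlow A (t - u) * laplacian A) i j) (Set.Ici 0) u := by
        have := (hasDerivAt_consensusFlow A (t - u) i j).comp_const_sub t u
        simpa using this.hasDerivWithinAt
      have := hP.smul (hy u ⟨hu.1, hu.2.trans_lt ht.2⟩ j)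
      rwa [← sum_laplacian_smul A (fun j => y j u)] at this
    have h2 := HasDerivWithinAt.fun_sum (u := Finset.univ) fun j _ => h1 j
    convert h2 using 1
    rw [Finset.sum_add_distrib]
    simp only [smul_neg, Finset.sum_neg_distrib, Finset.smul_sum, smul_smul, Matrix.mul_apply,
      Finset.sum_smul]
    rw [Finset.sum_comm]
    simp
  have hc := constant_of_has_deriv_right_zero (f := fun u => ∑ j, consensusFlow A (t - u) i j • y j u)
    (a := 0) (b := t) (fun u hu => ((hd u hu).continuousWithinAt).mono fun v hv => hv.1)
    (fun u hu => (hd u ⟨hu.1, hu.2.le⟩).mono (Set.Ici_subset_Ici.2 hu.1)) t ⟨ht.1, le_rfl⟩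
  simpa [consensusFlow_zero, Matrix.one_apply, ite_smul] using hc

theorem hasDerivAt_sum_consensusFlow {E : Type*} [NormedAddCommGroup E] [NormedSpace ℝ E]
    (A : Matrix V V ℝ) (c : V → E) (t : ℝ) (i : V) :
    HasDerivAt (fun u => ∑ j, consensusFlow A u i j • c j)
      (-∑ k, A i k • (∑ j, consensusFlow A t i j • c j - ∑ j, consensusFlow A t k j • c j)) t := by
  have h := HasDerivAt.fun_sum (u := Finset.univ)
    fun j _ => (hasDerivAt_consensusFlow' A t i j).smul_const (c j)
  convert h using 1
  rw [← sum_laplacian_smul A (fun k => ∑ j, consensusFlow A t k j • c j)]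
  simp only [neg_smul, Finset.sum_neg_distrib, Finset.smul_sum, smul_smul, Matrix.mul_apply,
    Finset.sum_smul]
  rw [Finset.sum_comm]

/-- The constant family `1` solves the consensus equation, so uniqueness gives the row sums. -/
theorem sum_consensusFlow (A : Matrix V V ℝ) {t : ℝ} (ht : 0 ≤ t) (i : V) :
    ∑ j, consensusFlow A t i j = 1 := by
  have h := eq_consensusFlow_of_hasDerivWithinAt A (fun _ _ => (1 : ℝ)) (T := t + 1)
    (fun u _ i => by simpa using hasDerivWithinAt_const u (Set.Ici 0) (1 : ℝ))
    (t := t) ⟨ht, by linarith⟩ i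
  simpa using h.symm

/-! ### Sign and support of the consensus flow. -/

/-- The nonnegative matrix `c - L`, where `c` is the sum of all weights. -/
def shiftedLaplacian (A : Matrix V V ℝ) : Matrix V V ℝ :=
  (∑ i, ∑ j, A i j) • (1 : Matrix V V ℝ) - laplacian A

theorem shiftedLaplacian_apply_ne (A : Matrix V V ℝ) {i j : V} (h : i ≠ j) :
    shiftedLaplacian A i j = A i j := by
  simp [shiftedLaplacian, laplacian, h]

theorem shiftedLaplacian_nonneg {A : Matrix V V ℝ} (hA : ∀ i j, 0 ≤ A i j) (i j : V) :
    0 ≤ shiftedLaplacian A i j := by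
  by_cases h : i = j
  · subst h
    have h1 : ∑ j, A i j ≤ ∑ i, ∑ j, A i j := Finset.single_le_sum
      (f := fun i => ∑ j, A i j) (fun i _ => Finset.sum_nonneg fun j _ => hA i j)
      (Finset.mem_univ i)
    have h2 := hA i i
    simp only [shiftedLaplacian, laplacian, Matrix.sub_apply, Matrix.smul_apply,
      Matrix.one_apply_eq, Matrix.diagonal_apply_eq, smul_eq_mul, mul_one]
    linarith
  · rw [shiftedLaplacian_apply_ne A h]
    exact hA i j

/-- Uniformization: `-L = -c + (c - L)` with `c` scalar, so `e^{-tL} = e^{-tc} e^{t(c - L)}`. The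
sign and the support of the flow can thus be read off from the powers of `c - L`. -/
theorem hasSum_consensusFlow (A : Matrix V V ℝ) (t : ℝ) (i j : V) :
    HasSum (fun k : ℕ => Real.exp (-(t * ∑ i, ∑ j, A i j)) *
      ((k.factorial : ℝ)⁻¹ * (t ^ k * (shiftedLaplacian A ^ k) i j))) (consensusFlow A t i j) := by
  have h := NormedSpace.exp_series_hasSum_exp' (𝕂 := ℝ) (t • shiftedLaplacian A)
  have h1 : HasSum (fun k : ℕ => ((k.factorial : ℝ)⁻¹ • (t • shiftedLaplacian A) ^ k) i j)
      (NormedSpace.exp (t • shiftedLaplacian A) i j) := Pi.hasSum.1 (Pi.hasSum.1 h i) j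
  have h2 := h1.mul_left (Real.exp (-(t * ∑ i, ∑ j, A i j)))
  have h3 : consensusFlow A t = Real.exp (-(t * ∑ i, ∑ j, A i j)) •
      NormedSpace.exp (t • shiftedLaplacian A) := by
    have e : t • (-laplacian A) = algebraMap ℝ (Matrix V V ℝ) (-(t * ∑ i, ∑ j, A i j))
        + t • shiftedLaplacian A := by
      rw [shiftedLaplacian, Algebra.algebraMap_eq_smul_one, smul_sub, smul_smul]
      module
    have e' : NormedSpace.exp (algebraMap ℝ (Matrix V V ℝ) (-(t * ∑ i, ∑ j, A i j)))
        = algebraMap ℝ (Matrix V V ℝ) (Real.exp (-(t * ∑ i, ∑ j, A i j))) := by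
      rw [Real.exp_eq_exp_ℝ]
      exact (NormedSpace.algebraMap_exp_comm (𝔸 := Matrix V V ℝ) _).symm
    rw [consensusFlow, e, Matrix.exp_add_of_commute _ _ (Algebra.commute_algebraMap_left _ _), e',
      ← Algebra.smul_def]
  rw [h3]
  simpa [smul_pow] using h2

theorem shiftedLaplacian_pow_nonneg {A : Matrix V V ℝ} (hA : ∀ i j, 0 ≤ A i j) (k : ℕ) (i j : V) :
    0 ≤ (shiftedLaplacian A ^ k) i j := by
  induction k generalizing i j with
  | zero => rw [pow_zero, Matrix.one_apply]; split_ifs <;> simp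
  | succ k ih =>
    rw [pow_succ, Matrix.mul_apply]
    exact Finset.sum_nonneg fun l _ => mul_nonneg (ih _ _) (shiftedLaplacian_nonneg hA _ _)

theorem consensusFlow_nonneg {A : Matrix V V ℝ} (hA : ∀ i j, 0 ≤ A i j) {t : ℝ} (ht : 0 ≤ t)
    (i j : V) : 0 ≤ consensusFlow A t i j :=
  (hasSum_consensusFlow A t i j).nonneg fun k => by
    have := shiftedLaplacian_pow_nonneg hA k i j
    positivity

/-- The flow does not let influence enter a set without incoming edges. -/
theorem consensusFlow_eq_zero {A : Matrix V V ℝ} {S : Set V}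
    (hS : ∀ i ∈ S, ∀ j ∉ S, A i j = 0) (t : ℝ) {i j : V} (hi : i ∈ S) (hj : j ∉ S) :
    consensusFlow A t i j = 0 := by
  have hp : ∀ (k : ℕ) (j : V), j ∉ S → (shiftedLaplacian A ^ k) i j = 0 := by
    intro k
    induction k with
    | zero =>
      intro j hj
      rw [pow_zero, Matrix.one_apply_ne]
      rintro rfl
      exact hj hi
    | succ k ih =>
      intro j hj
      rw [pow_succ, Matrix.mul_apply]
      refine Finset.sum_eq_zero fun l _ => ?_
      -- Every two-stage term vanishes: either its last factor enters `S` from outside, or the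
      -- earlier power already does.
      by_cases hl : l ∈ S
      · rw [shiftedLaplacian_apply_ne A (fun h : l = j => hj (h ▸ hl)), hS l hl j hj, mul_zero]
      · rw [ih l hl, zero_mul]
  refine (hasSum_consensusFlow A t i j).unique ?_
  simp [hp _ j hj, hasSum_zero]

/-- A path with `k` edges makes the `k`-th term of the series positive, and no other term is
negative. Loops are excluded from the paths because only the off-diagonal entries of `c - L` are
weights. -/
theorem consensusFlow_pos {A : Matrix V V ℝ} (hA : ∀ i j, 0 ≤ A i j) {t : ℝ} (ht : 0 < t)
    {i j : V} (h : Relation.ReflTransGen (fun u v => u ≠ v ∧ 0 < A v u) j i) :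
    0 < consensusFlow A t i j := by
  have hp : ∃ k : ℕ, 0 < (shiftedLaplacian A ^ k) i j := by
    induction h with
    | refl => exact ⟨0, by simp⟩
    | @tail l i _ hl ih =>
      obtain ⟨k, hk⟩ := ih
      refine ⟨k + 1, ?_⟩
      rw [pow_succ', Matrix.mul_apply]
      refine Finset.sum_pos' (fun m _ => mul_nonneg (shiftedLaplacian_nonneg hA _ _)
        (shiftedLaplacian_pow_nonneg hA _ _ _)) ⟨l, Finset.mem_univ l, mul_pos ?_ hk⟩
      rw [shiftedLaplacian_apply_ne A hl.1.symm]
      exact hl.2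
  obtain ⟨k, hk⟩ := hp
  refine lt_of_lt_of_le ?_ (le_hasSum (hasSum_consensusFlow A t i j) k fun m _ => ?_)
  · positivity
  · have := shiftedLaplacian_pow_nonneg hA m i j
    positivity

/-! ### Averaging, contraction and convergence of the flow. -/

theorem sum_consensusFlow_mul_mem_Icc {A : Matrix V V ℝ} (hA : ∀ i j, 0 ≤ A i j) {t : ℝ}
    (ht : 0 ≤ t) {u : V → ℝ} {a b : ℝ} (hu : ∀ j, u j ∈ Set.Icc a b) (i : V) :
    ∑ j, consensusFlow A t i j * u j ∈ Set.Icc a b := by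
  have h1 := sum_consensusFlow A ht i
  constructor
  · calc a = ∑ j, consensusFlow A t i j * a := by rw [← Finset.sum_mul, h1, one_mul]
      _ ≤ _ := Finset.sum_le_sum fun j _ =>
        mul_le_mul_of_nonneg_left (hu j).1 (consensusFlow_nonneg hA ht i j)
  · calc _ ≤ ∑ j, consensusFlow A t i j * b := Finset.sum_le_sum fun j _ =>
        mul_le_mul_of_nonneg_left (hu j).2 (consensusFlow_nonneg hA ht i j)
      _ = b := by rw [← Finset.sum_mul, h1, one_mul]

theorem norm_sum_consensusFlow_smul_le {E : Type*} [NormedAddCommGroup E] [NormedSpace ℝ E]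
    {A : Matrix V V ℝ} (hA : ∀ i j, 0 ≤ A i j) {t : ℝ}
    (ht : 0 ≤ t) {c : V → E} {R : ℝ} (hc : ∀ j, ‖c j‖ ≤ R) (i : V) :
    ‖∑ j, consensusFlow A t i j • c j‖ ≤ R := by
  calc _ ≤ ∑ j, consensusFlow A t i j * R := norm_sum_le_of_le _ fun j _ => by
        rw [norm_smul, Real.norm_of_nonneg (consensusFlow_nonneg hA ht i j)]
        exact mul_le_mul_of_nonneg_left (hc j) (consensusFlow_nonneg hA ht i j)
    _ = R := by rw [← Finset.sum_mul, sum_consensusFlow A ht i, one_mul]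

/-- A common influence on all agents contracts the range of their values. -/
theorem sum_consensusFlow_mul_contract {A : Matrix V V ℝ} (hA : ∀ i j, 0 ≤ A i j) {t : ℝ}
    (ht : 0 ≤ t) {r : V} {ε : ℝ} (hε : ∀ i, ε ≤ consensusFlow A t i r)
    {u : V → ℝ} {a b : ℝ} (hu : ∀ j, u j ∈ Set.Icc a b) (i : V) :
    ∑ j, consensusFlow A t i j * u j ∈ Set.Icc (a + ε * (u r - a)) (b - ε * (b - u r)) := by
  have h1 := sum_consensusFlow A ht i
  have key : ∀ w : V → ℝ, (∀ j, 0 ≤ w j) → ε * w r ≤ ∑ j, consensusFlow A t i j * w j := by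
    intro w hw
    exact (mul_le_mul_of_nonneg_right (hε i) (hw r)).trans
      (Finset.single_le_sum (f := fun j => consensusFlow A t i j * w j)
        (fun j _ => mul_nonneg (consensusFlow_nonneg hA ht i j) (hw j)) (Finset.mem_univ r))
  -- Both bounds are one estimate, applied to the nonnegative functions `u - a` and `b - u`.
  have ha := key (fun j => u j - a) fun j => sub_nonneg.2 (hu j).1
  have hb := key (fun j => b - u j) fun j => sub_nonneg.2 (hu j).2
  simp only [mul_sub, Finset.sum_sub_distrib, ← Finset.sum_mul, h1] at ha hb
  constructor <;> linarith

/-- Column `c` starts inside `[0, 1]`, every unit of time shrinks the enclosing interval by `1 - ε`,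
and further averaging never leaves an interval once it is reached. -/
theorem exists_Icc_consensusFlow {A : Matrix V V ℝ} (hA : ∀ i j, 0 ≤ A i j) {r : V} {ε : ℝ}
    (hε : ∀ i, ε ≤ consensusFlow A 1 i r) (c : V) (k : ℕ) :
    ∃ a b : ℝ, b - a = (1 - ε) ^ k ∧ ∀ t : ℝ, k ≤ t → ∀ i, consensusFlow A t i c ∈ Set.Icc a b := by
  have step : ∀ (s t : ℝ) (i : V), consensusFlow A (s + t) i c
      = ∑ j, consensusFlow A s i j * consensusFlow A t j c := fun s t i => by
    rw [consensusFlow_add, Matrix.mul_apply]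
  have main : ∃ a b : ℝ, b - a = (1 - ε) ^ k ∧ ∀ i, consensusFlow A k i c ∈ Set.Icc a b := by
    induction k with
    | zero =>
      refine ⟨0, 1, by simp, fun i => ?_⟩
      rw [Nat.cast_zero, consensusFlow_zero, Matrix.one_apply]
      split_ifs <;> simp
    | succ k ih =>
      obtain ⟨a, b, hab, h⟩ := ih
      refine ⟨a + ε * (consensusFlow A k r c - a), b - ε * (b - consensusFlow A k r c), ?_,
        fun i => ?_⟩
      · rw [pow_succ, ← hab]; ring
      · rw [Nat.cast_succ, add_comm (k : ℝ) 1, step]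
        exact sum_consensusFlow_mul_contract hA zero_le_one hε h i
  obtain ⟨a, b, hab, h⟩ := main
  refine ⟨a, b, hab, fun t ht i => ?_⟩
  have := sum_consensusFlow_mul_mem_Icc hA (sub_nonneg.2 ht) h i
  rwa [← step, sub_add_cancel] at this

theorem exists_tendsto_consensusFlow [Nonempty V] {A : Matrix V V ℝ} (hA : ∀ i j, 0 ≤ A i j)
    {r : V} (hr : ∀ i, Relation.ReflTransGen (fun u v => u ≠ v ∧ 0 < A v u) r i) (c : V) :
    ∃ p : ℝ, ∀ i, Filter.Tendsto (fun t => consensusFlow A t i c) Filter.atTop (𝓝 p) := by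
  obtain ⟨i₀, hi₀⟩ := Finite.exists_min fun i => consensusFlow A 1 i r
  set ε := consensusFlow A 1 i₀ r with hεdef
  have hε0 : 0 < ε := consensusFlow_pos hA one_pos (hr i₀)
  have hε1 : ε ≤ 1 := by
    rw [← sum_consensusFlow A zero_le_one i₀]
    exact Finset.single_le_sum (f := fun j => consensusFlow A 1 i₀ j)
      (fun j _ => consensusFlow_nonneg hA zero_le_one _ j) (Finset.mem_univ r)
  -- Comparing different rows as well as different times yields both convergence and a limit that
  -- does not depend on the row.
  have hcauchy : ∀ η > 0, ∃ N : ℝ, ∀ s ≥ N, ∀ t ≥ N, ∀ i j,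
      |consensusFlow A s i c - consensusFlow A t j c| < η := by
    intro η hη
    obtain ⟨k, hk⟩ := exists_pow_lt_of_lt_one hη (by linarith : 1 - ε < 1)
    obtain ⟨a, b, hab, h⟩ := exists_Icc_consensusFlow hA hi₀ c k
    refine ⟨k, fun s hs t ht i j => ?_⟩
    have h1 := h s hs i
    have h2 := h t ht j
    rw [abs_lt]
    constructor <;> linarith [h1.1, h1.2, h2.1, h2.2]
  have hc : CauchySeq fun t => consensusFlow A t i₀ c := by
    rw [Metric.cauchySeq_iff]
    intro η hη
    obtain ⟨N, hN⟩ := hcauchy η hη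
    exact ⟨N, fun s hs t ht => by rw [Real.dist_eq]; exact hN s hs t ht _ _⟩
  obtain ⟨p, hp⟩ := cauchySeq_tendsto_of_complete hc
  refine ⟨p, fun i => ?_⟩
  have hd : Filter.Tendsto (fun t => consensusFlow A t i c - consensusFlow A t i₀ c)
      Filter.atTop (𝓝 0) := by
    rw [Metric.tendsto_atTop]
    intro η hη
    obtain ⟨N, hN⟩ := hcauchy η hη
    exact ⟨N, fun t ht => by rw [Real.dist_eq, sub_zero]; exact hN t ht t ht _ _⟩
  simpa using hd.add hp

theorem exists_tendsto_sum_consensusFlow [Nonempty V] {E : Type*} [NormedAddCommGroup E]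
    [NormedSpace ℝ E] {A : Matrix V V ℝ} (hA : ∀ i j, 0 ≤ A i j)
    {r : V} (hr : ∀ i, Relation.ReflTransGen (fun u v => u ≠ v ∧ 0 < A v u) r i) (c : V → E) :
    ∃ l : E, ∀ i, Filter.Tendsto (fun t => ∑ j, consensusFlow A t i j • c j)
      Filter.atTop (𝓝 l) := by
  choose p hp using exists_tendsto_consensusFlow hA hr
  exact ⟨∑ j, p j • c j, fun i => tendsto_finsetSum _ fun j _ => (hp j i).smul_const (c j)⟩

end Consensus

/-! ### Directed spanning trees and reachability -/

section Trees

variable {V : Type*}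

/-- `v` can be reached from `r` along a path with `k` edges. -/
def ReachableIn (G : Digraph V) (r : V) : ℕ → V → Prop
  | 0, v => v = r
  | k + 1, v => ∃ u, ReachableIn G r k u ∧ G.Adj u v

theorem exists_reachableIn {G : Digraph V} {r v : V} (h : Relation.ReflTransGen G.Adj r v) :
    ∃ k, ReachableIn G r k v := by
  induction h with
  | refl => exact ⟨0, rfl⟩
  | tail _ hl ih =>
    obtain ⟨k, hk⟩ := ih
    exact ⟨k + 1, _, hk, hl⟩

/-- Breadth-first tree: `Nat.find (hex v)` is the distance from `r` to `v`, and each `v ≠ r` keeps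
one parent that is strictly closer to `r`. Following parents therefore ends at `r`. -/
theorem hasDirectedSpanningTree_of_root {G : Digraph V} {r : V}
    (hr : ∀ v, Relation.ReflTransGen G.Adj r v) : HasDirectedSpanningTree G := by
  classical
  have hex := fun v => exists_reachableIn (hr v)
  have hpar : ∀ v, v ≠ r → ∃ u, G.Adj u v ∧ Nat.find (hex u) < Nat.find (hex v) := by
    intro v hv
    have hs := Nat.find_spec (hex v)
    rcases hk : Nat.find (hex v) with _ | k
    · rw [hk] at hs
      exact absurd hs hv
    · rw [hk] at hs
      obtain ⟨u, hu, huv⟩ := hs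
      exact ⟨u, huv, Nat.lt_succ_of_le (Nat.find_min' _ hu)⟩
  choose! par hadj hlt using hpar
  refine ⟨⟨fun u v => v ≠ r ∧ u = par v⟩, ?_, r, fun u h => h.1 rfl,
    fun v hv => ⟨par v, ⟨hv, rfl⟩, fun u hu => hu.2⟩, ?_⟩
  · rintro u v ⟨hv, rfl⟩
    exact hadj v hv
  · intro v
    induction hk : Nat.find (hex v) using Nat.strong_induction_on generalizing v with
    | _ k ih =>
      by_cases hv : v = r
      · rw [hv]
      · exact (ih _ (hk ▸ hlt v hv) (par v) rfl).tail ⟨hv, rfl⟩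

theorem hasDirectedSpanningTree_iff {G : Digraph V} :
    HasDirectedSpanningTree G ↔ ∃ r, ∀ v, Relation.ReflTransGen G.Adj r v := by
  constructor
  · rintro ⟨T, hT, r, -, -, hr⟩
    exact ⟨r, fun v => Relation.ReflTransGen.mono (fun _ _ h => hT h) _ _ (hr v)⟩
  · rintro ⟨r, hr⟩
    exact hasDirectedSpanningTree_of_root hr

/-- Without a directed spanning tree there are two disjoint sets of vertices that no edge enters. -/
theorem exists_disjoint_of_not_hasDirectedSpanningTree [Finite V] [Nonempty V] {G : Digraph V}
    (h : ¬ HasDirectedSpanningTree G) :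
    ∃ S T : Set V, S.Nonempty ∧ T.Nonempty ∧ Disjoint S T ∧
      (∀ u v, G.Adj u v → v ∈ S → u ∈ S) ∧ ∀ u v, G.Adj u v → v ∈ T → u ∈ T := by
  -- Take `a` with the fewest ancestors. As `a` is not a root, it misses some `v`; the two sets are
  -- the ancestors of `a` and those of `v`.
  obtain ⟨a, ha⟩ := Finite.exists_min fun a : V => {u | Relation.ReflTransGen G.Adj u a}.ncard
  obtain ⟨v, hv⟩ : ∃ v, ¬ Relation.ReflTransGen G.Adj a v := by
    by_contra! hcon
    exact h (hasDirectedSpanningTree_iff.2 ⟨a, hcon⟩)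
  refine ⟨{u | Relation.ReflTransGen G.Adj u a}, {u | Relation.ReflTransGen G.Adj u v},
    ⟨a, .refl⟩, ⟨v, .refl⟩, ?_, fun u w huw hw => hw.head huw, fun u w huw hw => hw.head huw⟩
  rw [Set.disjoint_left]
  intro u hua huv
  -- By minimality a common ancestor `u` has exactly the ancestors of `a`. Then `a` reaches `u`,
  -- hence `v`, a contradiction.
  have hsub : {w | Relation.ReflTransGen G.Adj w u} ⊆ {w | Relation.ReflTransGen G.Adj w a} :=
    fun w hw => Relation.ReflTransGen.trans hw hua
  have heq := Set.eq_of_subset_of_ncard_le hsub (ha u)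
  have hau : a ∈ {w | Relation.ReflTransGen G.Adj w u} := heq ▸ Relation.ReflTransGen.refl
  exact hv (Relation.ReflTransGen.trans hau huv)

end Trees

/-! ### The quaternion logarithm -/

theorem re_sq_add_norm_im_sq (r : ℍ[ℝ]) : r.re ^ 2 + ‖r.im‖ ^ 2 = ‖r‖ ^ 2 := by
  simp only [sq, ← Quaternion.normSq_eq_norm_mul_self, Quaternion.normSq_def']
  simp
  ring

theorem neg_one_lt_re {r : ℍ[ℝ]} (h : ‖r‖ = 1) (h1 : r ≠ -1) : -1 < r.re := by
  have h2 := re_sq_add_norm_im_sq r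
  rw [h] at h2
  by_contra! hcon
  have h3 : r.re = -1 := by nlinarith [sq_nonneg ‖r.im‖]
  have h4 : ‖r.im‖ = 0 := by
    rw [h3] at h2
    nlinarith [sq_nonneg ‖r.im‖]
  rw [norm_eq_zero] at h4
  apply h1
  rw [← Quaternion.re_add_im r, h3, h4]
  simp

theorem re_le_one {r : ℍ[ℝ]} (h : ‖r‖ = 1) : r.re ≤ 1 := by
  have h2 := re_sq_add_norm_im_sq r
  rw [h] at h2
  nlinarith [sq_nonneg ‖r.im‖]

theorem norm_im_eq_sin {r : ℍ[ℝ]} (h : ‖r‖ = 1) : ‖r.im‖ = Real.sin (halfAngle r) := by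
  have h2 := re_sq_add_norm_im_sq r
  rw [halfAngle, Real.sin_arccos, ← Real.sqrt_sq (norm_nonneg r.im)]
  rw [h] at h2
  congr 1
  linarith

theorem cos_halfAngle {r : ℍ[ℝ]} (h : ‖r‖ = 1) : Real.cos (halfAngle r) = r.re :=
  Real.cos_arccos (by nlinarith [re_sq_add_norm_im_sq r, sq_nonneg ‖r.im‖]) (re_le_one h)

theorem halfAngle_lt_pi {r : ℍ[ℝ]} (h : ‖r‖ = 1) (h1 : r ≠ -1) : halfAngle r < Real.pi := by
  have h2 := neg_one_lt_re h h1
  refine lt_of_le_of_ne (Real.arccos_le_pi _) fun h3 => ?_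
  rw [halfAngle, Real.arccos_eq_pi] at h3
  linarith

theorem sinc_halfAngle_pos {r : ℍ[ℝ]} (h : ‖r‖ = 1) (h1 : r ≠ -1) :
    0 < Real.sinc (halfAngle r) := by
  rcases (Real.arccos_nonneg r.re).eq_or_lt with h0 | h0
  · rw [halfAngle, ← h0, Real.sinc_zero]
    exact one_pos
  · rw [halfAngle, Real.sinc_of_ne_zero h0.ne']
    exact div_pos (Real.sin_pos_of_pos_of_lt_pi h0 (halfAngle_lt_pi h h1)) h0

theorem eq_one_of_im_eq_zero {r : ℍ[ℝ]} (h : ‖r‖ = 1) (h1 : r ≠ -1) (h0 : r.im = 0) : r = 1 := by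
  have h2 := re_sq_add_norm_im_sq r
  have h3 := neg_one_lt_re h h1
  have h4 : r.re = 1 := by
    rw [h, h0, norm_zero] at h2
    nlinarith
  rw [← Quaternion.re_add_im r, h4, h0]
  simp

/-- Unlike the normalized axis, the factor `1 / sinc` is continuous at `r = 1`; this form carries
the differentiation of the logarithm there. -/
theorem logQuat_eq_inv_sinc {r : ℍ[ℝ]} (h : ‖r‖ = 1) :
    logQuat r = (Real.sinc (halfAngle r))⁻¹ • r.im := by
  by_cases h0 : r.im = 0
  · simp [logQuat, axis, h0]
  · have h1 : halfAngle r ≠ 0 := fun h1 => h0 <| by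
      rw [← norm_eq_zero, norm_im_eq_sin h, h1, Real.sin_zero]
    rw [logQuat, axis, norm_im_eq_sin h, smul_smul, Real.sinc_of_ne_zero h1, inv_div, div_eq_mul_inv]

theorem logQuat_re (r : ℍ[ℝ]) : (logQuat r).re = 0 := by
  simp [logQuat, axis]

theorem norm_logQuat {r : ℍ[ℝ]} (h : ‖r‖ = 1) (h1 : r ≠ -1) : ‖logQuat r‖ = halfAngle r := by
  have hs := sinc_halfAngle_pos h h1
  have hn : 0 ≤ halfAngle r := Real.arccos_nonneg _
  rw [logQuat_eq_inv_sinc h, norm_smul, norm_im_eq_sin h, norm_inv, Real.norm_of_nonneg hs.le]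
  rw [inv_mul_eq_iff_eq_mul₀ hs.ne']
  rcases eq_or_ne (halfAngle r) 0 with h0 | h0
  · simp [h0]
  · rw [Real.sinc_of_ne_zero h0]
    field_simp

theorem norm_logQuat_lt_pi {r : ℍ[ℝ]} (h : ‖r‖ = 1) (h1 : r ≠ -1) : ‖logQuat r‖ < Real.pi :=
  (norm_logQuat h h1).trans_lt (halfAngle_lt_pi h h1)

theorem exp_eq_cos_add_sinc {y : ℍ[ℝ]} (hy : y.re = 0) :
    NormedSpace.exp y = ↑(Real.cos ‖y‖) + Real.sinc ‖y‖ • y := by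
  rw [Quaternion.exp_of_re_eq_zero y hy]
  by_cases h : y = 0
  · simp [h]
  · rw [Real.sinc_of_ne_zero (norm_ne_zero_iff.2 h)]

theorem exp_logQuat {r : ℍ[ℝ]} (h : ‖r‖ = 1) (h1 : r ≠ -1) : NormedSpace.exp (logQuat r) = r := by
  rw [exp_eq_cos_add_sinc (logQuat_re r), norm_logQuat h h1, cos_halfAngle h,
    logQuat_eq_inv_sinc h, smul_smul, mul_inv_cancel₀ (sinc_halfAngle_pos h h1).ne', one_smul,
    Quaternion.re_add_im]

theorem norm_exp_of_re_eq_zero {y : ℍ[ℝ]} (hy : y.re = 0) : ‖NormedSpace.exp y‖ = 1 := by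
  rw [Quaternion.norm_exp, hy, NormedSpace.exp_zero, norm_one]

theorem re_exp_of_re_eq_zero {y : ℍ[ℝ]} (hy : y.re = 0) :
    (NormedSpace.exp y).re = Real.cos ‖y‖ := by
  rw [exp_eq_cos_add_sinc hy]
  simp [hy]

theorem im_exp_of_re_eq_zero {y : ℍ[ℝ]} (hy : y.re = 0) :
    (NormedSpace.exp y).im = Real.sinc ‖y‖ • y := by
  have hy' : y.im = y := by rw [← Quaternion.sub_re_self, hy]; simp
  rw [exp_eq_cos_add_sinc hy, Quaternion.im_add, Quaternion.im_coe, Quaternion.im_smul, hy', zero_add]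

theorem exp_ne_neg_one {y : ℍ[ℝ]} (hy : y.re = 0) (h : ‖y‖ < Real.pi) :
    NormedSpace.exp y ≠ -1 := by
  intro h1
  have h2 := re_exp_of_re_eq_zero hy
  rw [h1] at h2
  have h3 := Real.cos_lt_cos_of_nonneg_of_le_pi (norm_nonneg y) le_rfl h
  rw [Real.cos_pi, ← h2] at h3
  simp at h3

theorem logQuat_exp {y : ℍ[ℝ]} (hy : y.re = 0) (h : ‖y‖ < Real.pi) :
    logQuat (NormedSpace.exp y) = y := by
  have hn := norm_exp_of_re_eq_zero hy
  have ha : halfAngle (NormedSpace.exp y) = ‖y‖ := by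
    rw [halfAngle, re_exp_of_re_eq_zero hy, Real.arccos_cos (norm_nonneg y) h.le]
  have hs := sinc_halfAngle_pos hn (exp_ne_neg_one hy h)
  rw [logQuat_eq_inv_sinc hn, im_exp_of_re_eq_zero hy, smul_smul]
  rw [ha] at hs ⊢
  rw [inv_mul_cancel₀ hs.ne', one_smul]

/-! ### Differentiating the logarithm along curves of unit quaternions. -/

/-- The imaginary part as a continuous linear map. -/
def imCLM : ℍ[ℝ] →L[ℝ] ℍ[ℝ] where
  toFun := Quaternion.im
  map_add' := Quaternion.im_add
  map_smul' c q := Quaternion.im_smul q c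
  cont := Quaternion.continuous_im

/-- The real part as a continuous linear map. -/
def reCLM : ℍ[ℝ] →L[ℝ] ℝ where
  toFun := fun q => q.re
  map_add' _ _ := rfl
  map_smul' _ _ := rfl
  cont := Quaternion.continuous_re

/-- The derivative of the logarithm along curves of unit quaternions. -/
def logQuatDeriv (r : ℍ[ℝ]) : ℍ[ℝ] →L[ℝ] ℍ[ℝ] :=
  open Classical in if r.im = 0 then imCLM else fderiv ℝ logQuat r

/-- A product rule with a merely continuous scalar factor: where `f` vanishes, the slope of `h • f`
is `h u` times the slope of `f`. -/
theorem hasDerivWithinAt_smul_of_eq_zero {E : Type*} [NormedAddCommGroup E] [NormedSpace ℝ E]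
    {h : ℝ → ℝ} {f : ℝ → E} {f' : E} {s : Set ℝ} {t : ℝ} (hh : ContinuousWithinAt h s t)
    (hf : HasDerivWithinAt f f' s t) (h0 : f t = 0) :
    HasDerivWithinAt (fun u => h u • f u) (h t • f') s t := by
  rw [hasDerivWithinAt_iff_tendsto_slope] at hf ⊢
  have := (hh.mono_left (nhdsWithin_mono t Set.sdiff_subset)).smul hf
  refine this.congr fun u => ?_
  simp [slope, h0, smul_comm (h u)]

theorem differentiableAt_logQuat {r : ℍ[ℝ]} (h : ‖r‖ = 1) (h0 : r.im ≠ 0) :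
    DifferentiableAt ℝ logQuat r := by
  have h2 := re_sq_add_norm_im_sq r
  have h3 : 0 < ‖r.im‖ := norm_pos_iff.2 h0
  rw [h] at h2
  have hre : DifferentiableAt ℝ (fun q : ℍ[ℝ] => q.re) r := reCLM.differentiableAt
  have him : DifferentiableAt ℝ (fun q : ℍ[ℝ] => q.im) r := imCLM.differentiableAt
  have ha : DifferentiableAt ℝ (fun q : ℍ[ℝ] => Real.arccos q.re) r :=
    (Real.differentiableAt_arccos.2 ⟨by nlinarith, by nlinarith⟩).comp r hre
  exact ha.smul (((him.norm ℝ h0).inv h3.ne').smul him)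

/-- At `r t = 1` the function `arccos` is not differentiable, so the restriction to unit curves is
essential: along them the logarithm is a continuous factor, equal to `1` at `t`, times the vanishing
imaginary part. Elsewhere the chain rule applies. -/
theorem hasDerivWithinAt_logQuat {r : ℝ → ℍ[ℝ]} {r' : ℍ[ℝ]} {s : Set ℝ} {t : ℝ} (ht : t ∈ s)
    (hr : HasDerivWithinAt r r' s t) (hs : ∀ u ∈ s, ‖r u‖ = 1) (h1 : r t ≠ -1) :
    HasDerivWithinAt (fun u => logQuat (r u)) (logQuatDeriv (r t) r') s t := by
  by_cases h0 : (r t).im = 0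
  · rw [logQuatDeriv, if_pos h0]
    have ha : ContinuousWithinAt (fun u => (Real.sinc (halfAngle (r u)))⁻¹) s t := by
      refine ContinuousWithinAt.inv₀ ?_ (sinc_halfAngle_pos (hs t ht) h1).ne'
      exact (Real.continuous_sinc.comp
        (Real.continuous_arccos.comp Quaternion.continuous_re)).continuousAt.comp_continuousWithinAt
          hr.continuousWithinAt
    have hi : HasDerivWithinAt (fun u => (r u).im) (imCLM r') s t :=
      imCLM.hasFDerivAt.comp_hasDerivWithinAt t hr
    have := hasDerivWithinAt_smul_of_eq_zero ha hi h0
    have e : Real.sinc (halfAngle (r t)) = 1 := by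
      rw [eq_one_of_im_eq_zero (hs t ht) h1 h0, halfAngle]
      simp
    rw [e, inv_one, one_smul] at this
    exact this.congr (fun u hu => logQuat_eq_inv_sinc (hs u hu)) (logQuat_eq_inv_sinc (hs t ht))
  · rw [logQuatDeriv, if_neg h0]
    exact (differentiableAt_logQuat (hs t ht) h0).hasFDerivAt.comp_hasDerivWithinAt t hr

/-! ### The differential of the exponential map in coordinates -/

/-- The quaternion with a given coefficient vector. -/
def quatOfVec4 (v : Fin 4 → ℝ) : ℍ[ℝ] := ⟨v 0, v 1, v 2, v 3⟩

theorem quatOfVec4_vec4 (h : ℍ[ℝ]) : quatOfVec4 (vec4 h) = h := rfl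

theorem vec4_quatOfVec4 (v : Fin 4 → ℝ) : vec4 (quatOfVec4 v) = v := by
  ext i; fin_cases i <;> rfl

theorem vec3_pureOfVec3 (v : Fin 3 → ℝ) : vec3 (pureOfVec3 v) = v := by
  ext i; fin_cases i <;> rfl

theorem pureOfVec3_vec3 {h : ℍ[ℝ]} (hh : h.re = 0) : pureOfVec3 (vec3 h) = h := by
  ext <;> simp [pureOfVec3, vec3, hh]

theorem pureOfVec3_re (v : Fin 3 → ℝ) : (pureOfVec3 v).re = 0 := rfl

theorem vec4_mul_eq_plus (a b : ℍ[ℝ]) : vec4 (a * b) = (hamiltonPlus4 a).mulVec (vec4 b) := by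
  ext i
  fin_cases i <;> simp [vec4, hamiltonPlus4, Matrix.mulVec, dotProduct, Fin.sum_univ_four] <;> ring

theorem vec4_mul_eq_minus (a b : ℍ[ℝ]) : vec4 (a * b) = (hamiltonMinus4 b).mulVec (vec4 a) := by
  ext i
  fin_cases i <;> simp [vec4, hamiltonMinus4, Matrix.mulVec, dotProduct, Fin.sum_univ_four] <;> ring

theorem vec4_pureOfVec3 (v : Fin 3 → ℝ) : vec4 (pureOfVec3 v) = Qp.mulVec v := by
  ext i
  fin_cases i <;> simp [vec4, Qp, pureOfVec3, Matrix.mulVec, dotProduct, Fin.sum_univ_three]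

/-- `vec4` as a continuous linear map. -/
def vec4CLM : ℍ[ℝ] →L[ℝ] (Fin 4 → ℝ) :=
  LinearMap.toContinuousLinearMap
    { toFun := vec4
      map_add' := fun a b => by ext i; fin_cases i <;> simp [vec4]
      map_smul' := fun c a => by ext i; fin_cases i <;> simp [vec4] }

/-- `quatOfVec4` as a continuous linear map. -/
def quatOfVec4CLM : (Fin 4 → ℝ) →L[ℝ] ℍ[ℝ] :=
  LinearMap.toContinuousLinearMap
    { toFun := quatOfVec4
      map_add' := fun a b => by ext; exacts [rfl, rfl, rfl, rfl]
      map_smul' := fun c a => by ext; exacts [rfl, rfl, rfl, rfl] }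

/-- `vec3` as a continuous linear map. -/
def vec3CLM : ℍ[ℝ] →L[ℝ] (Fin 3 → ℝ) :=
  LinearMap.toContinuousLinearMap
    { toFun := vec3
      map_add' := fun a b => by ext i; fin_cases i <;> simp [vec3]
      map_smul' := fun c a => by ext i; fin_cases i <;> simp [vec3] }

/-- `pureOfVec3` as a continuous linear map. -/
def pureOfVec3CLM : (Fin 3 → ℝ) →L[ℝ] ℍ[ℝ] :=
  LinearMap.toContinuousLinearMap
    { toFun := pureOfVec3
      map_add' := fun a b => by ext; exacts [(add_zero _).symm, rfl, rfl, rfl]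
      map_smul' := fun c a => by ext; exacts [(mul_zero c).symm, rfl, rfl, rfl] }

/-- The quaternion with coefficient vector `Q(r) w`. -/
def quatQ (r : ℍ[ℝ]) (w : Fin 3 → ℝ) : ℍ[ℝ] := quatOfVec4 ((Q r).mulVec w)

theorem vec4_quatQ (r : ℍ[ℝ]) (w : Fin 3 → ℝ) : vec4 (quatQ r w) = (Q r).mulVec w :=
  vec4_quatOfVec4 _

theorem quatQ_neg (r : ℍ[ℝ]) (w : Fin 3 → ℝ) : quatQ r (-w) = -quatQ r w := by
  rw [quatQ, Matrix.mulVec_neg]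
  exact map_neg quatOfVec4CLM _

theorem hasDerivWithinAt_exp_pureOfVec3 {r : ℍ[ℝ]} {v : ℝ → Fin 3 → ℝ} {w : Fin 3 → ℝ} {s : Set ℝ}
    {t : ℝ} (hv : HasDerivWithinAt v w s t) (hr : v t = vec3 (logQuat r)) :
    HasDerivWithinAt (fun u => NormedSpace.exp (pureOfVec3 (v u))) (quatQ r w) s t := by
  have hd : DifferentiableAt ℝ (fun v : Fin 3 → ℝ => vec4 (NormedSpace.exp (pureOfVec3 v)))
      (v t) := by
    have h1 : DifferentiableAt ℝ (NormedSpace.exp : ℍ[ℝ] → ℍ[ℝ]) (pureOfVec3 (v t)) :=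
      (NormedSpace.exp_analytic (𝕂 := ℝ) _).differentiableAt
    exact vec4CLM.differentiableAt.comp _ (h1.comp _ pureOfVec3CLM.differentiableAt)
  have h2 := hd.hasFDerivAt.comp_hasDerivWithinAt t hv
  have h3 := quatOfVec4CLM.hasFDerivAt.comp_hasDerivWithinAt t h2
  have e : quatQ r w = quatOfVec4CLM
      (fderiv ℝ (fun v : Fin 3 → ℝ => vec4 (NormedSpace.exp (pureOfVec3 v))) (v t) w) := by
    rw [quatQ, Q, ← Matrix.toLin'_apply, Matrix.toLin'_toMatrix', hr]
    rfl
  rw [e]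
  exact h3

/-- `Q (exp y)` is the Jacobian at `log (exp y)`, which is `y` only for `‖y‖ < π`. -/
theorem hasDerivWithinAt_exp {y : ℝ → ℍ[ℝ]} {w : Fin 3 → ℝ} {s : Set ℝ} {t : ℝ}
    (hy : HasDerivWithinAt y (pureOfVec3 w) s t) (hs : ∀ u ∈ s, (y u).re = 0) (ht : t ∈ s)
    (hpi : ‖y t‖ < Real.pi) :
    HasDerivWithinAt (fun u => NormedSpace.exp (y u)) (quatQ (NormedSpace.exp (y t)) w) s t := by
  have h1 : HasDerivWithinAt (fun u => vec3 (y u)) (vec3 (pureOfVec3 w)) s t :=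
    vec3CLM.hasFDerivAt.comp_hasDerivWithinAt t hy
  rw [vec3_pureOfVec3] at h1
  have h2 := hasDerivWithinAt_exp_pureOfVec3 (r := NormedSpace.exp (y t)) h1
    (by rw [logQuat_exp (hs t ht) hpi])
  exact h2.congr (fun u hu => by rw [pureOfVec3_vec3 (hs u hu)]) (by rw [pureOfVec3_vec3 (hs t ht)])

/-- No formula for `Q` is needed: differentiate `log (exp y) = y` along the line through `log r` in
direction `w`. The identity persists near `0` because `‖log r‖ < π` is an open condition. -/
theorem logQuatDeriv_quatQ {r : ℍ[ℝ]} (h : ‖r‖ = 1) (h1 : r ≠ -1) (w : Fin 3 → ℝ) :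
    logQuatDeriv r (quatQ r w) = pureOfVec3 w := by
  set y : ℝ → ℍ[ℝ] := fun u => logQuat r + u • pureOfVec3 w with hy
  have hre : ∀ u, (y u).re = 0 := fun u => by simp [hy, logQuat_re, pureOfVec3_re]
  have hy0 : y 0 = logQuat r := by simp [hy]
  have hd : HasDerivAt y (pureOfVec3 w) 0 := by
    simpa [hy] using ((hasDerivAt_id (0 : ℝ)).smul_const (pureOfVec3 w)).const_add (logQuat r)
  have hpi : ‖y 0‖ < Real.pi := by rw [hy0]; exact norm_logQuat_lt_pi h h1
  have he := (hasDerivWithinAt_exp (s := Set.univ) hd.hasDerivWithinAt (fun u _ => hre u)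
    (Set.mem_univ _) hpi)
  rw [hy0, exp_logQuat h h1] at he
  have hl := hasDerivWithinAt_logQuat (Set.mem_univ _) he
    (fun u _ => norm_exp_of_re_eq_zero (hre u)) (exp_ne_neg_one (hre 0) hpi)
  rw [hasDerivWithinAt_univ, hy0, exp_logQuat h h1] at hl
  refine hl.unique (hd.congr_of_eventuallyEq ?_)
  have hev : ∀ᶠ u in 𝓝 0, ‖y u‖ < Real.pi :=
    (continuous_norm.continuousAt.comp hd.continuousAt).eventually_lt_const hpi
  filter_upwards [hev] with u hu
  exact logQuat_exp (hre u) hu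

/-! ### Dual quaternions -/

@[simp] theorem fst_mkDQ (a b : ℍ[ℝ]) : (mkDQ a b).fst = a := by simp [mkDQ]

@[simp] theorem snd_mkDQ (a b : ℍ[ℝ]) : (mkDQ a b).snd = b := by simp [mkDQ]

theorem dq_ext {x y : DualQuat} (h1 : x.fst = y.fst) (h2 : x.snd = y.snd) : x = y :=
  TrivSqZeroExt.ext h1 h2

theorem snd_mul_dq (x y : DualQuat) : (x * y).snd = x.fst * y.snd + x.snd * y.fst :=
  DualNumber.snd_mul x y

@[simp] theorem fst_conj (x : DualQuat) : (conj x).fst = star x.fst := fst_mkDQ _ _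

@[simp] theorem snd_conj (x : DualQuat) : (conj x).snd = star x.snd := snd_mkDQ _ _

theorem conj_mul (x y : DualQuat) : conj (x * y) = conj y * conj x := by
  refine dq_ext (by simp) ?_
  simp only [snd_conj, snd_mul_dq, fst_conj, star_add, star_mul]
  rw [add_comm]

theorem conj_conj (x : DualQuat) : conj (conj x) = x := dq_ext (by simp) (by simp)

theorem mul_star_eq_one {r : ℍ[ℝ]} (h : ‖r‖ = 1) : r * star r = 1 := by
  rw [Quaternion.self_mul_star, Quaternion.normSq_eq_norm_mul_self, h]
  simp

theorem star_mul_eq_one {r : ℍ[ℝ]} (h : ‖r‖ = 1) : star r * r = 1 := by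
  rw [Quaternion.star_mul_self, Quaternion.normSq_eq_norm_mul_self, h]
  simp

/-- For `x = r + ε x'`, the product `x x*` equals `|r|² + 2 ε Re (x' r*)`; the second condition says
that the translation is pure. -/
theorem isUnitDQ_iff {x : DualQuat} :
    IsUnitDQ x ↔ ‖x.fst‖ = 1 ∧ (x.snd * star x.fst).re = 0 := by
  have h1 : (x * conj x).fst = ((‖x.fst‖ * ‖x.fst‖ : ℝ) : ℍ[ℝ]) := by
    rw [TrivSqZeroExt.fst_mul, fst_conj, Quaternion.self_mul_star,
      Quaternion.normSq_eq_norm_mul_self]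
  have h2 : (x * conj x).snd = ((2 * (x.snd * star x.fst).re : ℝ) : ℍ[ℝ]) := by
    have e : x.fst * star x.snd = star (x.snd * star x.fst) := by simp
    rw [snd_mul_dq, fst_conj, snd_conj, e, add_comm, Quaternion.self_add_star]
    rw [Quaternion.coe_mul]
    rfl
  constructor
  · intro h
    rw [IsUnitDQ] at h
    rw [h] at h1 h2
    constructor
    · have h3 : (1 : ℝ) = ‖x.fst‖ * ‖x.fst‖ := by
        have := congrArg (fun q : ℍ[ℝ] => q.re) h1
        simpa using this
      nlinarith [norm_nonneg x.fst]
    · have := congrArg (fun q : ℍ[ℝ] => q.re) h2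
      simpa using this
  · rintro ⟨h3, h4⟩
    refine dq_ext ?_ ?_
    · rw [h1, h3]; simp
    · rw [h2, h4]; simp

theorem IsUnitDQ.norm_fst {x : DualQuat} (h : IsUnitDQ x) : ‖x.fst‖ = 1 := (isUnitDQ_iff.1 h).1

theorem IsUnitDQ.conj_mul_self {x : DualQuat} (h : IsUnitDQ x) : conj x * x = 1 := by
  have h1 := star_mul_eq_one h.norm_fst
  refine dq_ext (by simpa using h1) ?_
  have h2 := congrArg TrivSqZeroExt.snd h
  rw [snd_mul_dq, fst_conj, snd_conj, TrivSqZeroExt.snd_one] at h2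
  rw [snd_mul_dq, fst_conj, snd_conj, TrivSqZeroExt.snd_one]
  -- Inserting `r* r = 1` exhibits this as `r* (⋯) r`, where `⋯` is the vanishing dual part of `x
  -- x*`.
  calc star x.fst * x.snd + star x.snd * x.fst
      = star x.fst * x.snd * (star x.fst * x.fst) + (star x.fst * x.fst) * star x.snd * x.fst := by
        rw [h1, mul_one, one_mul]
    _ = star x.fst * (x.fst * star x.snd + x.snd * star x.fst) * x.fst := by noncomm_ring
    _ = 0 := by rw [h2]; simp

theorem IsUnitDQ.conj {x : DualQuat} (h : IsUnitDQ x) : IsUnitDQ (PoseFormation.conj x) := by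
  rw [IsUnitDQ, conj_conj]
  exact h.conj_mul_self

theorem IsUnitDQ.mul {x y : DualQuat} (hx : IsUnitDQ x) (hy : IsUnitDQ y) : IsUnitDQ (x * y) := by
  rw [IsUnitDQ] at *
  rw [conj_mul, mul_assoc, ← mul_assoc y, hy, one_mul, hx]

theorem center_mul {x δ : DualQuat} (hδ : IsUnitDQ δ) : center x δ * δ = x := by
  rw [center, mul_assoc, hδ.conj_mul_self, mul_one]

theorem center_mul_right {x δ : DualQuat} (hδ : IsUnitDQ δ) : center (x * δ) δ = x := by
  rw [IsUnitDQ] at hδ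
  rw [center, mul_assoc, hδ, mul_one]

theorem hasDerivWithinAt_dq_iff {x : ℝ → DualQuat} {x' : DualQuat} {s : Set ℝ} {t : ℝ} :
    HasDerivWithinAt x x' s t ↔ HasDerivWithinAt (fun u => (x u).fst) x'.fst s t ∧
      HasDerivWithinAt (fun u => (x u).snd) x'.snd s t := by
  constructor
  · intro h
    -- The dual quaternions are definitionally the product space.
    have h' : HasDerivWithinAt (F := ℍ[ℝ] × ℍ[ℝ]) x x' s t := h
    exact ⟨(ContinuousLinearMap.fst ℝ ℍ[ℝ] ℍ[ℝ]).hasFDerivAt.comp_hasDerivWithinAt t h',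
      (ContinuousLinearMap.snd ℝ ℍ[ℝ] ℍ[ℝ]).hasFDerivAt.comp_hasDerivWithinAt t h'⟩
  · rintro ⟨h1, h2⟩
    have h' : HasDerivWithinAt (F := ℍ[ℝ] × ℍ[ℝ]) x x' s t := h1.prodMk h2
    exact h'

theorem hasDerivWithinAt_dq_mul_const {x : ℝ → DualQuat} {x' : DualQuat} {s : Set ℝ} {t : ℝ}
    (h : HasDerivWithinAt x x' s t) (c : DualQuat) :
    HasDerivWithinAt (fun u => x u * c) (x' * c) s t := by
  rw [hasDerivWithinAt_dq_iff] at h ⊢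
  simp only [TrivSqZeroExt.fst_mul, snd_mul_dq]
  exact ⟨h.1.mul_const _, (h.1.mul_const _).add (h.2.mul_const _)⟩

theorem tendsto_dq_iff {ι : Type*} {x : ι → DualQuat} {a : DualQuat} {l : Filter ι} :
    Filter.Tendsto x l (𝓝 a) ↔ Filter.Tendsto (fun u => (x u).fst) l (𝓝 a.fst) ∧
      Filter.Tendsto (fun u => (x u).snd) l (𝓝 a.snd) :=
  Prod.tendsto_iff x a

theorem vec8_mul (a b : DualQuat) : vec8 (a * b) = (hamiltonMinus8 b).mulVec (vec8 a) := by
  rw [vec8, vec8, hamiltonMinus8, Matrix.fromBlocks_mulVec]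
  simp only [Sum.elim_comp_inl, Sum.elim_comp_inr, Matrix.zero_mulVec, add_zero, snd_mul_dq,
    TrivSqZeroExt.fst_mul, ← vec4_mul_eq_minus]
  congr 1
  exact map_add vec4CLM _ _

theorem vec4_injective : Function.Injective vec4 := fun a b h => by
  rw [← quatOfVec4_vec4 a, h, quatOfVec4_vec4]

theorem vec8_injective : Function.Injective vec8 := by
  intro a b h
  refine dq_ext (vec4_injective (funext fun k => ?_)) (vec4_injective (funext fun k => ?_))
  · exact congrFun h (Sum.inl k)
  · exact congrFun h (Sum.inr k)

/-- The dual quaternion with coefficient vector `Q₈(x) w`, where `w` consists of `w₁` and `w₂`. -/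
def dqQ (x : DualQuat) (w₁ w₂ : Fin 3 → ℝ) : DualQuat :=
  mkDQ (quatQ x.fst w₁) (x.snd * star x.fst * quatQ x.fst w₁ + pureOfVec3 w₂ * x.fst)

theorem vec8_dqQ (x : DualQuat) (w₁ w₂ : Fin 3 → ℝ) :
    vec8 (dqQ x w₁ w₂) = (Q8 x).mulVec (Sum.elim w₁ w₂) := by
  rw [vec8, Q8, Matrix.fromBlocks_mulVec]
  simp only [Sum.elim_comp_inl, Sum.elim_comp_inr, Matrix.zero_mulVec, add_zero, dqQ, fst_mkDQ,
    snd_mkDQ, Matrix.smul_mulVec, ← Matrix.mulVec_mulVec, rotation, vec4_quatQ]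
  congr 1
  rw [← vec4_quatQ, ← vec4_pureOfVec3, ← vec4_mul_eq_plus, ← vec4_mul_eq_minus]
  have h : x.snd * star x.fst * quatQ x.fst w₁
      = (1 / 2 : ℝ) • (translation x * quatQ x.fst w₁) := by
    rw [translation, smul_mul_assoc, smul_smul]
    norm_num
  rw [h]
  exact (map_add vec4CLM _ _).trans (congrArg (· + _) (map_smul vec4CLM _ _))

/-- Quaternion conjugation as a continuous linear map. -/
def starCLM : ℍ[ℝ] →L[ℝ] ℍ[ℝ] where
  toFun := star
  map_add' := star_add
  map_smul' c a := by ext <;> simp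
  cont := continuous_star

theorem hasDerivWithinAt_star {f : ℝ → ℍ[ℝ]} {f' : ℍ[ℝ]} {s : Set ℝ} {t : ℝ}
    (h : HasDerivWithinAt f f' s t) : HasDerivWithinAt (fun u => star (f u)) (star f') s t :=
  starCLM.hasFDerivAt.comp_hasDerivWithinAt t h

/-- Differentiate `r r* = 1` along the exponential of a line through `log r`. -/
theorem quatQ_tangent {r : ℍ[ℝ]} (h : ‖r‖ = 1) (h1 : r ≠ -1) (w : Fin 3 → ℝ) :
    quatQ r w * star r + r * star (quatQ r w) = 0 := by
  have hre : ∀ u : ℝ, (logQuat r + u • pureOfVec3 w).re = 0 := fun u => by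
    simp [logQuat_re, pureOfVec3_re]
  have hd : HasDerivAt (fun u : ℝ => logQuat r + u • pureOfVec3 w) (pureOfVec3 w) 0 := by
    simpa using ((hasDerivAt_id (0 : ℝ)).smul_const (pureOfVec3 w)).const_add (logQuat r)
  have he := hasDerivWithinAt_exp (s := Set.univ) hd.hasDerivWithinAt (fun u _ => hre u)
    (Set.mem_univ _) (by simpa using norm_logQuat_lt_pi h h1)
  simp only [zero_smul, add_zero, exp_logQuat h h1] at he
  have hm := he.mul (hasDerivWithinAt_star he)
  simp only [zero_smul, add_zero, exp_logQuat h h1, hasDerivWithinAt_univ] at hm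
  refine hm.unique ((hasDerivAt_const (0 : ℝ) (1 : ℍ[ℝ])).congr_of_eventuallyEq ?_)
  exact Filter.Eventually.of_forall fun u => mul_star_eq_one (norm_exp_of_re_eq_zero (hre u))

theorem mul_quatQ_mul_star {r : ℍ[ℝ]} (h : ‖r‖ = 1) (h1 : r ≠ -1) (w : Fin 3 → ℝ) :
    star r * quatQ r w * star r = -star (quatQ r w) := by
  have h2 := congrArg (star r * ·) (quatQ_tangent h h1 w)
  simp only [mul_add, ← mul_assoc, star_mul_eq_one h, one_mul, mul_zero] at h2
  exact eq_neg_of_add_eq_zero_left h2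

/-- This yields purity of the twist, which is `-2 v x_c*`. The primary part is pure by tangency; the
dual part has the form `a - a* + p` with `p` pure. -/
theorem isPureDQ_dqQ_mul_conj {x : DualQuat} (hx : InLogDomain x) (w₁ w₂ : Fin 3 → ℝ) :
    IsPureDQ (dqQ x w₁ w₂ * conj x) := by
  have hn := hx.1.norm_fst
  have ht := mul_quatQ_mul_star hn hx.2 w₁
  constructor
  · have h := congrArg (fun q : ℍ[ℝ] => q.re) (quatQ_tangent hn hx.2 w₁)
    have e : x.fst * star (quatQ x.fst w₁) = star (quatQ x.fst w₁ * star x.fst) := by simp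
    simp only [e, Quaternion.re_add, Quaternion.re_star, Quaternion.re_zero] at h
    simp only [TrivSqZeroExt.fst_mul, dqQ, fst_mkDQ, fst_conj]
    linarith
  · have e : (dqQ x w₁ w₂ * conj x).snd
        = quatQ x.fst w₁ * star x.snd - star (quatQ x.fst w₁ * star x.snd) + pureOfVec3 w₂ := by
      rw [snd_mul_dq, dqQ, fst_mkDQ, snd_mkDQ, fst_conj, snd_conj, add_mul, mul_assoc _ x.fst,
        mul_star_eq_one hn, mul_assoc x.snd, mul_assoc x.snd, ht]
      simp
      abel
    rw [e, Quaternion.re_add, Quaternion.re_sub, Quaternion.re_star, pureOfVec3_re]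
    simp

/-! ### The protocol in terms of the centers -/

theorem output_fst (x δ : DualQuat) : (output x δ).fst = logQuat (center x δ).fst := fst_mkDQ _ _

theorem output_snd (x δ : DualQuat) :
    (output x δ).snd = (center x δ).snd * star (center x δ).fst := by
  rw [output, logDQ, snd_mkDQ, translation, smul_smul]
  norm_num

variable {n : ℕ}

/-- The disagreement of agent `i` with its parents. -/
def disagreement (G : WeightedDigraph n) (y : Fin n → ℍ[ℝ]) (i : Fin n) : ℍ[ℝ] :=
  ∑ j, G.A i j • (y i - y j)

theorem disagreement_re (G : WeightedDigraph n) {y : Fin n → ℍ[ℝ]} (hy : ∀ i, (y i).re = 0)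
    (i : Fin n) : (disagreement G y i).re = 0 := by
  have h : reCLM (disagreement G y i) = 0 := by
    rw [disagreement, map_sum]
    refine Finset.sum_eq_zero fun j _ => ?_
    rw [map_smul, map_sub]
    have h : ∀ k, reCLM (y k) = 0 := hy
    simp [h]
  exact h

/-- The velocity of the center of agent `i` is the negative of this. -/
def centerVelocity (G : WeightedDigraph n) (δ x : Fin n → DualQuat) (i : Fin n) : DualQuat :=
  dqQ (center (x i) (δ i))
    (vec3 (disagreement G (fun j => (output (x j) (δ j)).fst) i))
    (vec3 (disagreement G (fun j => (output (x j) (δ j)).snd) i))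

theorem formationProtocol_eq (G : WeightedDigraph n) (δ x : Fin n → DualQuat) (i : Fin n) :
    formationProtocol G δ x i
      = vec8 ((-2 : ℝ) • (centerVelocity G δ x i * δ i * conj (x i))) := by
  have h : (∑ j, G.A i j • vec6 (output (x i) (δ i) - output (x j) (δ j)))
      = Sum.elim (vec3 (disagreement G (fun j => (output (x j) (δ j)).fst) i))
        (vec3 (disagreement G (fun j => (output (x j) (δ j)).snd) i)) := by
    have h1 : ∀ y : Fin n → ℍ[ℝ],
        vec3 (disagreement G y i) = ∑ j, G.A i j • vec3 (y i - y j) := fun y => by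
      change vec3CLM _ = ∑ j, G.A i j • vec3CLM _
      simp [disagreement, map_sum]
    ext k
    rcases k with k | k <;>
      simp [h1, vec6, Finset.sum_apply]
  have h8 : ∀ (c : ℝ) (a : DualQuat), vec8 (c • a) = c • vec8 a := by
    intro c a
    ext k
    rcases k with k | k
    · exact congrFun (map_smul vec4CLM c a.fst) k
    · exact congrFun (map_smul vec4CLM c a.snd) k
  rw [formationProtocol, h, ← Matrix.mulVec_mulVec, ← Matrix.mulVec_mulVec, ← vec8_dqQ, ← vec8_mul,
    ← vec8_mul, ← h8]
  rfl

theorem vec8_eq_formationProtocol_iff (G : WeightedDigraph n) (δ x : Fin n → DualQuat) (i : Fin n)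
    (ξ : DualQuat) : vec8 ξ = formationProtocol G δ x i ↔
      ξ = (-2 : ℝ) • (centerVelocity G δ x i * δ i * conj (x i)) := by
  rw [formationProtocol_eq]
  exact vec8_injective.eq_iff

theorem half_smul_protocol_mul {v x δ : DualQuat} (hx : IsUnitDQ x) :
    (1 / 2 : ℝ) • ((-2 : ℝ) • (v * δ * conj x) * x) = -(v * δ) := by
  have h : (-2 : ℝ) • (v * δ * conj x) * x = (-2 : ℝ) • (v * δ) := by
    have h1 : ∀ (c : ℝ) (a b : DualQuat), c • a * b = c • (a * b) := fun c a b =>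
      dq_ext (by simp) (by simp [smul_add])
    rw [h1, mul_assoc, hx.conj_mul_self, mul_one]
  rw [h, smul_smul]
  norm_num

variable {n : ℕ}

/-! ### From closed loops to linear consensus -/

theorem output_fst_re (x δ : DualQuat) : (output x δ).fst.re = 0 := by
  rw [output_fst, logQuat_re]

theorem output_snd_re {x δ : DualQuat} (h : IsUnitDQ (center x δ)) :
    (output x δ).snd.re = 0 := by
  rw [output_snd]
  exact (isUnitDQ_iff.1 h).2

theorem isUnitDQ_center {x δ : DualQuat} (hx : IsUnitDQ x) (hδ : IsUnitDQ δ) :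
    IsUnitDQ (center x δ) := hx.mul hδ.conj

theorem weight_nonneg (G : WeightedDigraph n) (i j : Fin n) : 0 ≤ G.A i j := by
  by_cases h : G.Adj j i
  · exact (G.A_pos i j h).le
  · rw [G.A_zero i j h]

theorem IsClosedLoop.hasDerivWithinAt_center {G : WeightedDigraph n} {δ : Fin n → DualQuat}
    {x ξ : Fin n → ℝ → DualQuat} (h : IsClosedLoop G δ x ξ) (hδ : ∀ i, IsUnitDQ (δ i))
    (i : Fin n) {t : ℝ} (ht : 0 ≤ t) :
    HasDerivWithinAt (fun u => center (x i u) (δ i)) (-centerVelocity G δ (fun j => x j t) i)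
      (Set.Ici 0) t := by
  have h1 := hasDerivWithinAt_dq_mul_const (h.kinematics i t ht) (conj (δ i))
  rw [(vec8_eq_formationProtocol_iff G δ _ i _).1 (h.protocol i t ht),
    half_smul_protocol_mul (h.unit i t ht), neg_mul, mul_assoc, (hδ i : δ i * conj (δ i) = 1),
    mul_one] at h1
  exact h1

/-- The linearization. For rotations, the derivative of the logarithm undoes `Q`. For translations,
write `s` for the dual part, `q` for `Q(r) w` and `d` for the disagreement: `(s r*)' = -(s r* q + d
r) r* - s q*`, and `r* q r* = -q*` reduces this to `-d`. -/
theorem IsClosedLoop.hasDerivWithinAt_output {G : WeightedDigraph n} {δ : Fin n → DualQuat}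
    {x ξ : Fin n → ℝ → DualQuat} (h : IsClosedLoop G δ x ξ) (hδ : ∀ i, IsUnitDQ (δ i))
    (i : Fin n) {t : ℝ} (ht : 0 ≤ t) (hi : (center (x i t) (δ i)).fst ≠ -1) :
    HasDerivWithinAt (fun u => (output (x i u) (δ i)).fst)
        (-disagreement G (fun j => (output (x j t) (δ j)).fst) i) (Set.Ici 0) t ∧
      HasDerivWithinAt (fun u => (output (x i u) (δ i)).snd)
        (-disagreement G (fun j => (output (x j t) (δ j)).snd) i) (Set.Ici 0) t := by
  have hc := hasDerivWithinAt_dq_iff.1 (h.hasDerivWithinAt_center hδ i ht)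
  have hu : ∀ j, ∀ u ∈ Set.Ici (0 : ℝ), IsUnitDQ (center (x j u) (δ j)) := fun j u hu =>
    isUnitDQ_center (h.unit j u hu) (hδ j)
  have hn := (hu i t ht).norm_fst
  have hd1 := disagreement_re G (fun j => output_fst_re (x j t) (δ j)) i
  have hd2 := disagreement_re G (fun j => output_snd_re (hu j t ht)) i
  simp only [centerVelocity, dqQ, TrivSqZeroExt.fst_neg, TrivSqZeroExt.snd_neg, fst_mkDQ,
    snd_mkDQ] at hc
  constructor
  · have h1 := hasDerivWithinAt_logQuat (Set.mem_Ici.2 ht) hc.1 (fun u hu' => (hu i u hu').norm_fst)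
      hi
    rw [map_neg, logQuatDeriv_quatQ hn hi, pureOfVec3_vec3 hd1] at h1
    simpa only [output_fst] using h1
  · have h1 := hc.2.mul (hasDerivWithinAt_star hc.1)
    have h2 := mul_quatQ_mul_star hn hi
      (vec3 (disagreement G (fun j => (output (x j t) (δ j)).fst) i))
    simp only [output_snd]
    simp only [output_snd] at hd2
    refine h1.congr_deriv ?_
    rw [neg_mul, add_mul, star_neg, mul_neg, mul_assoc (pureOfVec3 _), mul_star_eq_one hn, mul_one,
      mul_assoc (center (x i t) (δ i)).snd, mul_assoc (center (x i t) (δ i)).snd, h2]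
    simp only [output_snd]
    rw [pureOfVec3_vec3 hd2]
    simp

/-- The outputs that start from `c` and obey the linear consensus dynamics. -/
def linearOutput (G : WeightedDigraph n) (c : Fin n → ℍ[ℝ]) (i : Fin n) (t : ℝ) : ℍ[ℝ] :=
  ∑ j, consensusFlow G.A t i j • c j

theorem hasDerivAt_linearOutput (G : WeightedDigraph n) (c : Fin n → ℍ[ℝ]) (i : Fin n) (t : ℝ) :
    HasDerivAt (linearOutput G c i) (-disagreement G (fun j => linearOutput G c j t) i) t :=
  hasDerivAt_sum_consensusFlow G.A c t i

theorem linearOutput_zero (G : WeightedDigraph n) (c : Fin n → ℍ[ℝ]) (i : Fin n) :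
    linearOutput G c i 0 = c i := by
  simp [linearOutput, consensusFlow_zero, Matrix.one_apply, ite_smul]

theorem linearOutput_re (G : WeightedDigraph n) {c : Fin n → ℍ[ℝ]} (hc : ∀ i, (c i).re = 0)
    (i : Fin n) (t : ℝ) : (linearOutput G c i t).re = 0 := by
  have h : reCLM (linearOutput G c i t) = 0 := by
    rw [linearOutput, map_sum]
    refine Finset.sum_eq_zero fun j _ => ?_
    have h : ∀ k, reCLM (c k) = 0 := hc
    rw [map_smul, h, smul_zero]
  exact h

theorem exists_norm_le_lt_pi [Nonempty (Fin n)] {c : Fin n → ℍ[ℝ]} (hc : ∀ i, ‖c i‖ < Real.pi) :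
    ∃ R < Real.pi, ∀ i, ‖c i‖ ≤ R := by
  obtain ⟨i, hi⟩ := Finite.exists_max fun i => ‖c i‖
  exact ⟨‖c i‖, hc i, hi⟩

theorem norm_linearOutput_le (G : WeightedDigraph n) {c : Fin n → ℍ[ℝ]} {R : ℝ}
    (hc : ∀ i, ‖c i‖ ≤ R) (i : Fin n) {t : ℝ} (ht : 0 ≤ t) : ‖linearOutput G c i t‖ ≤ R :=
  norm_sum_consensusFlow_smul_le (weight_nonneg G) ht hc i

theorem IsClosedLoop.output_eq_of_forall_lt {G : WeightedDigraph n} {δ : Fin n → DualQuat}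
    {x ξ : Fin n → ℝ → DualQuat} (h : IsClosedLoop G δ x ξ) (hδ : ∀ i, IsUnitDQ (δ i)) {T : ℝ}
    (hT : ∀ t ∈ Set.Ico 0 T, ∀ i, (center (x i t) (δ i)).fst ≠ -1) {t : ℝ} (ht : t ∈ Set.Ico 0 T)
    (i : Fin n) :
    (output (x i t) (δ i)).fst = linearOutput G (fun j => (output (x j 0) (δ j)).fst) i t ∧
      (output (x i t) (δ i)).snd = linearOutput G (fun j => (output (x j 0) (δ j)).snd) i t :=
  ⟨eq_consensusFlow_of_hasDerivWithinAt G.A (fun i u => (output (x i u) (δ i)).fst)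
      (fun u hu i => (h.hasDerivWithinAt_output hδ i hu.1 (hT u hu i)).1) ht i,
    eq_consensusFlow_of_hasDerivWithinAt G.A (fun i u => (output (x i u) (δ i)).snd)
      (fun u hu i => (h.hasDerivWithinAt_output hδ i hu.1 (hT u hu i)).2) ht i⟩

/-- The set of times at which some `f i` is at most `b` is a finite union of closed sets, so it
contains its infimum. -/
theorem exists_first_time {V : Type*} [Finite V] {f : V → ℝ → ℝ}
    (hf : ∀ i, ContinuousOn (f i) (Set.Ici 0)) {b : ℝ} {i₀ : V} {t₀ : ℝ} (ht₀ : 0 ≤ t₀)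
    (h₀ : f i₀ t₀ ≤ b) :
    ∃ T ≥ 0, (∃ i, f i T ≤ b) ∧ ∀ t ∈ Set.Ico 0 T, ∀ i, b < f i t := by
  set S : Set ℝ := ⋃ i, Set.Ici 0 ∩ f i ⁻¹' Set.Iic b with hS
  have hclosed : IsClosed S := isClosed_iUnion_of_finite fun i =>
    (hf i).preimage_isClosed_of_isClosed isClosed_Ici isClosed_Iic
  have hbdd : BddBelow S := ⟨0, by
    rintro t ht
    obtain ⟨i, hi⟩ := Set.mem_iUnion.1 ht
    exact hi.1⟩
  have hmem := hclosed.csInf_mem ⟨t₀, Set.mem_iUnion.2 ⟨i₀, ht₀, h₀⟩⟩ hbdd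
  obtain ⟨i, hi0, hi⟩ := Set.mem_iUnion.1 hmem
  refine ⟨sInf S, hi0, ⟨i, hi⟩, fun t ht j => ?_⟩
  by_contra! hcon
  exact absurd (csInf_le hbdd (Set.mem_iUnion.2 ⟨j, ht.1, hcon⟩)) (not_le.2 ht.2)

/-- The centers never leave the domain of the logarithm. -/
theorem IsClosedLoop.center_fst_ne {G : WeightedDigraph n} {δ : Fin n → DualQuat}
    {x ξ : Fin n → ℝ → DualQuat} (h : IsClosedLoop G δ x ξ) (hδ : ∀ i, IsUnitDQ (δ i))
    (ha : IsAdmissible δ fun i => x i 0) {t : ℝ} (ht : 0 ≤ t) (i : Fin n) :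
    (center (x i t) (δ i)).fst ≠ -1 := by
  intro hcon
  have hne : Nonempty (Fin n) := ⟨i⟩
  have hu : ∀ j, ∀ u ∈ Set.Ici (0 : ℝ), IsUnitDQ (center (x j u) (δ j)) := fun j u hu =>
    isUnitDQ_center (h.unit j u hu) (hδ j)
  have hcont : ∀ j, ContinuousOn (fun u => (center (x j u) (δ j)).fst.re) (Set.Ici 0) :=
    fun j u hu => Quaternion.continuous_re.continuousAt.comp_continuousWithinAt
      (hasDerivWithinAt_dq_iff.1 (h.hasDerivWithinAt_center hδ j hu)).1.continuousWithinAt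
  -- For a unit quaternion, real part at most `-1` means being `-1`, so `T` is the first exit time
  -- from the domain of the logarithm.
  obtain ⟨T, hT0, ⟨k, hk⟩, hT⟩ := exists_first_time hcont (b := -1) ht (i₀ := i) (by
    rw [hcon]; simp)
  have hlog : ∀ u ∈ Set.Ico 0 T, ∀ j, (center (x j u) (δ j)).fst ≠ -1 := fun u hu j h1 => by
    have := hT u hu j
    rw [h1] at this
    simp at this
  obtain ⟨R, hR, hRle⟩ := exists_norm_le_lt_pi (c := fun j => (output (x j 0) (δ j)).fst) fun j => by
    simpa only [output_fst] using norm_logQuat_lt_pi (hu j 0 Set.self_mem_Ici).norm_fst (ha j).2.2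
  have hR0 : 0 ≤ R := (norm_nonneg _).trans (hRle i)
  -- Before `T` the outputs follow the linear flow, so half angles stay below `R < π`. The resulting
  -- bound `cos R > -1` passes to time `T` by continuity.
  have hbound : ∀ u ∈ Set.Ico 0 T, Real.cos R ≤ (center (x k u) (δ k)).fst.re := by
    intro u hu'
    have h1 := (h.output_eq_of_forall_lt hδ hlog hu' k).1
    have h2 := norm_linearOutput_le G hRle k hu'.1
    rw [← h1, output_fst, norm_logQuat (hu k u hu'.1).norm_fst (hlog u hu' k)] at h2
    rw [← cos_halfAngle (hu k u hu'.1).norm_fst]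
    exact Real.cos_le_cos_of_nonneg_of_le_pi (Real.arccos_nonneg _) hR.le h2
  have hcos : -1 < Real.cos R := by
    rw [← Real.cos_pi]
    exact Real.cos_lt_cos_of_nonneg_of_le_pi hR0 le_rfl hR
  -- For `T = 0` the interval before `T` is empty, and admissibility is used instead.
  rcases hT0.eq_or_lt with h0 | h0
  · subst h0
    have := neg_one_lt_re (hu k 0 Set.self_mem_Ici).norm_fst (ha k).2.2
    exact absurd hk (not_le.2 this)
  · have hcl : T ∈ closure (Set.Ico 0 T) := by
      rw [closure_Ico h0.ne]
      exact ⟨h0.le, le_rfl⟩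
    have hcw : ContinuousWithinAt (fun u => (center (x k u) (δ k)).fst.re) (Set.Ico 0 T) T :=
      (hcont k T h0.le).mono fun u hu => hu.1
    have := ContinuousWithinAt.closure_le hcl continuousWithinAt_const hcw hbound
    linarith

theorem IsClosedLoop.output_eq {G : WeightedDigraph n} {δ : Fin n → DualQuat}
    {x ξ : Fin n → ℝ → DualQuat} (h : IsClosedLoop G δ x ξ) (hδ : ∀ i, IsUnitDQ (δ i))
    (ha : IsAdmissible δ fun i => x i 0) {t : ℝ} (ht : 0 ≤ t) (i : Fin n) :
    (output (x i t) (δ i)).fst = linearOutput G (fun j => (output (x j 0) (δ j)).fst) i t ∧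
      (output (x i t) (δ i)).snd = linearOutput G (fun j => (output (x j 0) (δ j)).snd) i t :=
  h.output_eq_of_forall_lt hδ (T := t + 1) (fun _ hu i => h.center_fst_ne hδ ha hu.1 i)
    ⟨ht, by linarith⟩ i

/-! ### From linear consensus to closed loops -/

/-- The unit dual quaternion with logarithm `y + ε z`. -/
def expDQ (y z : ℍ[ℝ]) : DualQuat := mkDQ (NormedSpace.exp y) (z * NormedSpace.exp y)

theorem isUnitDQ_expDQ {y z : ℍ[ℝ]} (hy : y.re = 0) (hz : z.re = 0) : IsUnitDQ (expDQ y z) := by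
  rw [isUnitDQ_iff, expDQ, fst_mkDQ, snd_mkDQ, mul_assoc,
    mul_star_eq_one (norm_exp_of_re_eq_zero hy), mul_one]
  exact ⟨norm_exp_of_re_eq_zero hy, hz⟩

theorem output_expDQ_fst {y z : ℍ[ℝ]} {δ : DualQuat} (hδ : IsUnitDQ δ) (hy : y.re = 0)
    (hpi : ‖y‖ < Real.pi) : (output (expDQ y z * δ) δ).fst = y := by
  rw [output_fst, center_mul_right hδ, expDQ, fst_mkDQ, logQuat_exp hy hpi]

theorem output_expDQ_snd {y z : ℍ[ℝ]} {δ : DualQuat} (hδ : IsUnitDQ δ) (hy : y.re = 0) :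
    (output (expDQ y z * δ) δ).snd = z := by
  rw [output_snd, center_mul_right hδ, expDQ, fst_mkDQ, snd_mkDQ, mul_assoc,
    mul_star_eq_one (norm_exp_of_re_eq_zero hy), mul_one]

theorem expDQ_output {x δ : DualQuat} (h : InLogDomain (center x δ)) :
    expDQ (output x δ).fst (output x δ).snd = center x δ := by
  have hn := h.1.norm_fst
  rw [expDQ, output_fst, output_snd, exp_logQuat hn h.2, mul_assoc, star_mul_eq_one hn, mul_one]
  exact dq_ext (fst_mkDQ _ _) (snd_mkDQ _ _)

/-- The linearization read backwards: exponentiate a linear solution and let the protocol define the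
twist. The bound by `π` ensures that the outputs recover `y`, so that the feedback acts on the
intended data. -/
theorem exists_isClosedLoop_of_linear (G : WeightedDigraph n) {δ : Fin n → DualQuat}
    (hδ : ∀ i, IsUnitDQ (δ i)) {y z : Fin n → ℝ → ℍ[ℝ]} (hy : ∀ i t, (y i t).re = 0)
    (hz : ∀ i t, (z i t).re = 0) (hpi : ∀ i t, 0 ≤ t → ‖y i t‖ < Real.pi)
    (hdy : ∀ i t, HasDerivAt (y i) (-disagreement G (fun j => y j t) i) t)
    (hdz : ∀ i t, HasDerivAt (z i) (-disagreement G (fun j => z j t) i) t) :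
    ∃ ξ : Fin n → ℝ → DualQuat,
      IsClosedLoop G δ (fun i t => expDQ (y i t) (z i t) * δ i) ξ ∧
        ∀ i t, 0 ≤ t → IsPureDQ (ξ i t) := by
  set x : Fin n → ℝ → DualQuat := fun i t => expDQ (y i t) (z i t) * δ i with hx
  have hU : ∀ i t, IsUnitDQ (expDQ (y i t) (z i t)) := fun i t => isUnitDQ_expDQ (hy i t) (hz i t)
  have hunit : ∀ i t, IsUnitDQ (x i t) := fun i t => (hU i t).mul (hδ i)
  have hcen : ∀ i t, center (x i t) (δ i) = expDQ (y i t) (z i t) := fun i t =>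
    center_mul_right (hδ i)
  refine ⟨fun i t => (-2 : ℝ) • (centerVelocity G δ (fun j => x j t) i * δ i * conj (x i t)),
    ⟨fun i t _ => hunit i t, fun i t ht => ?_, fun i t ht => ?_⟩, fun i t ht => ?_⟩
  · simp only [half_smul_protocol_mul (hunit i t)]
    rw [← neg_mul]
    refine hasDerivWithinAt_dq_mul_const ?_ _
    have hv : centerVelocity G δ (fun j => x j t) i = dqQ (expDQ (y i t) (z i t))
        (vec3 (disagreement G (fun j => y j t) i)) (vec3 (disagreement G (fun j => z j t) i)) := by
      have e1 : (fun j => (output (x j t) (δ j)).fst) = fun j => y j t :=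
        funext fun j => output_expDQ_fst (hδ j) (hy j t) (hpi j t ht)
      have e2 : (fun j => (output (x j t) (δ j)).snd) = fun j => z j t :=
        funext fun j => output_expDQ_snd (hδ j) (hy j t)
      rw [centerVelocity, hcen, e1, e2]
    have h1 : HasDerivWithinAt (y i) (pureOfVec3 (-vec3 (disagreement G (fun j => y j t) i)))
        (Set.Ici 0) t := by
      have e : pureOfVec3 (-vec3 (disagreement G (fun j => y j t) i))
          = -disagreement G (fun j => y j t) i :=
        (map_neg pureOfVec3CLM _).trans
          (congrArg Neg.neg (pureOfVec3_vec3 (disagreement_re G (fun j => hy j t) i)))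
      rw [e]
      exact (hdy i t).hasDerivWithinAt
    have h2 := hasDerivWithinAt_exp h1 (fun u _ => hy i u) ht (hpi i t ht)
    have h3 := (hdz i t).hasDerivWithinAt.mul h2
    have hn := mul_star_eq_one (norm_exp_of_re_eq_zero (hy i t))
    rw [hasDerivWithinAt_dq_iff, hv]
    rw [quatQ_neg] at h2 h3
    simp only [expDQ, dqQ, TrivSqZeroExt.fst_neg, TrivSqZeroExt.snd_neg, fst_mkDQ, snd_mkDQ]
    refine ⟨h2, h3.congr_deriv ?_⟩
    rw [pureOfVec3_vec3 (disagreement_re G (fun j => hz j t) i), mul_assoc (z i t), hn, mul_one]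
    rw [neg_mul, mul_neg, neg_add_rev]
  · exact (vec8_eq_formationProtocol_iff G δ _ i _).2 rfl
  · have hlog : InLogDomain (center (x i t) (δ i)) := by
      rw [hcen]
      refine ⟨hU i t, ?_⟩
      rw [rotation, expDQ, fst_mkDQ]
      exact exp_ne_neg_one (hy i t) (hpi i t ht)
    have hp := isPureDQ_dqQ_mul_conj hlog
      (vec3 (disagreement G (fun j => (output (x j t) (δ j)).fst) i))
      (vec3 (disagreement G (fun j => (output (x j t) (δ j)).snd) i))
    have e : δ i * conj (x i t) = conj (center (x i t) (δ i)) := by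
      rw [center, conj_mul (x i t), conj_conj]
    beta_reduce
    rw [mul_assoc, e]
    constructor
    · exact (congrArg ((-2 : ℝ) * ·) hp.1).trans (mul_zero _)
    · exact (congrArg ((-2 : ℝ) * ·) hp.2).trans (mul_zero _)

theorem exists_isClosedLoop (G : WeightedDigraph n) {δ : Fin n → DualQuat}
    (hδ : ∀ i, IsUnitDQ (δ i)) {c d : Fin n → ℍ[ℝ]} (hc : ∀ i, (c i).re = 0)
    (hd : ∀ i, (d i).re = 0) (hpi : ∀ i, ‖c i‖ < Real.pi) :
    ∃ ξ : Fin n → ℝ → DualQuat,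
      IsClosedLoop G δ (fun i t => expDQ (linearOutput G c i t) (linearOutput G d i t) * δ i) ξ ∧
        ∀ i t, 0 ≤ t → IsPureDQ (ξ i t) := by
  refine exists_isClosedLoop_of_linear G hδ (fun i t => linearOutput_re G hc i t)
    (fun i t => linearOutput_re G hd i t) (fun i t ht => ?_)
    (fun i t => hasDerivAt_linearOutput G c i t) (fun i t => hasDerivAt_linearOutput G d i t)
  have hne : Nonempty (Fin n) := ⟨i⟩
  obtain ⟨R, hR, hRle⟩ := exists_norm_le_lt_pi hpi
  exact (norm_linearOutput_le G hRle i ht).trans_lt hR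

theorem exists_isClosedLoop_of_isAdmissible (G : WeightedDigraph n) {δ : Fin n → DualQuat}
    (hδ : ∀ i, IsUnitDQ (δ i)) {x₀ : Fin n → DualQuat} (h : IsAdmissible δ x₀) :
    ∃ x ξ : Fin n → ℝ → DualQuat, IsClosedLoop G δ x ξ ∧
      (∀ i t, 0 ≤ t → IsPureDQ (ξ i t)) ∧ ∀ i, x i 0 = x₀ i := by
  obtain ⟨ξ, h1, h2⟩ := exists_isClosedLoop G hδ
    (c := fun i => (output (x₀ i) (δ i)).fst) (d := fun i => (output (x₀ i) (δ i)).snd)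
    (fun i => output_fst_re _ _) (fun i => output_snd_re (h i).2.1) fun i => by
      simpa only [output_fst] using norm_logQuat_lt_pi (h i).2.1.norm_fst (h i).2.2
  refine ⟨_, ξ, h1, h2, fun i => ?_⟩
  simp only [linearOutput_zero]
  rw [expDQ_output (h i).2, center_mul (hδ i)]

/-! ### Consensus and formation -/

theorem exists_tendsto_linearOutput [Nonempty (Fin n)] {G : WeightedDigraph n}
    (hG : HasDirectedSpanningTree G.toDigraph) (c : Fin n → ℍ[ℝ]) :
    ∃ l, ∀ i, Filter.Tendsto (linearOutput G c i) Filter.atTop (𝓝 l) := by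
  obtain ⟨r, hr⟩ := hasDirectedSpanningTree_iff.1 hG
  refine exists_tendsto_sum_consensusFlow (weight_nonneg G) (r := r) (fun i => ?_) c
  refine Relation.ReflTransGen.mono (fun u v huv => ⟨?_, G.A_pos v u huv⟩) _ _ (hr i)
  rintro rfl
  exact G.loopless u huv

theorem achievesOutputConsensus_of_hasDirectedSpanningTree [Nonempty (Fin n)] {G : WeightedDigraph n}
    {δ : Fin n → DualQuat} (hδ : ∀ i, IsUnitDQ (δ i)) (hG : HasDirectedSpanningTree G.toDigraph) :
    AchievesOutputConsensus G δ := by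
  intro x ξ h ha i j
  obtain ⟨l, hl⟩ := exists_tendsto_linearOutput hG fun j => (output (x j 0) (δ j)).fst
  obtain ⟨m, hm⟩ := exists_tendsto_linearOutput hG fun j => (output (x j 0) (δ j)).snd
  rw [tendsto_dq_iff]
  constructor
  · have := (hl i).sub (hl j)
    rw [sub_self] at this
    refine this.congr' ?_
    filter_upwards [Filter.eventually_ge_atTop 0] with t ht
    rw [TrivSqZeroExt.fst_sub, (h.output_eq hδ ha ht i).1, (h.output_eq hδ ha ht j).1]
  · have := (hm i).sub (hm j)
    rw [sub_self] at this
    refine this.congr' ?_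
    filter_upwards [Filter.eventually_ge_atTop 0] with t ht
    rw [TrivSqZeroExt.snd_sub, (h.output_eq hδ ha ht i).2, (h.output_eq hδ ha ht j).2]

theorem achievesFormation_of_hasDirectedSpanningTree [Nonempty (Fin n)] {G : WeightedDigraph n}
    {δ : Fin n → DualQuat} (hδ : ∀ i, IsUnitDQ (δ i)) (hG : HasDirectedSpanningTree G.toDigraph) :
    AchievesFormation G δ := by
  intro x ξ h ha
  set c : Fin n → ℍ[ℝ] := fun j => (output (x j 0) (δ j)).fst with hc
  set d : Fin n → ℍ[ℝ] := fun j => (output (x j 0) (δ j)).snd with hd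
  obtain ⟨l, hl⟩ := exists_tendsto_linearOutput hG c
  obtain ⟨m, hm⟩ := exists_tendsto_linearOutput hG d
  have i₀ : Fin n := Classical.arbitrary _
  -- The limits must be pure for their exponential to be a unit dual quaternion.
  have hpure : ∀ {e : Fin n → ℍ[ℝ]} {k : ℍ[ℝ]}, (∀ i, (e i).re = 0) →
      Filter.Tendsto (linearOutput G e i₀) Filter.atTop (𝓝 k) → k.re = 0 := by
    intro e k he hk
    refine tendsto_nhds_unique ((Quaternion.continuous_re.tendsto k).comp hk) ?_
    simp [Function.comp_def, linearOutput_re G he]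
  have hlre : l.re = 0 := hpure (fun i => output_fst_re _ _) (hl i₀)
  have hmre : m.re = 0 := hpure (fun i => output_snd_re (ha i).2.1) (hm i₀)
  refine ⟨expDQ l m, isUnitDQ_expDQ hlre hmre, fun i => ?_⟩
  have hexp : Filter.Tendsto (fun t => NormedSpace.exp (linearOutput G c i t)) Filter.atTop
      (𝓝 (NormedSpace.exp l)) := by
    have hce : ContinuousAt (NormedSpace.exp : ℍ[ℝ] → ℍ[ℝ]) l :=
      (NormedSpace.exp_analytic (𝕂 := ℝ) l).continuousAt
    exact hce.tendsto.comp (hl i)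
  have key : Filter.Tendsto
      (fun t => expDQ (linearOutput G c i t) (linearOutput G d i t) * δ i) Filter.atTop
      (𝓝 (expDQ l m * δ i)) := by
    simp only [tendsto_dq_iff, TrivSqZeroExt.fst_mul, snd_mul_dq, expDQ, fst_mkDQ, snd_mkDQ]
    exact ⟨hexp.mul_const _, (hexp.mul_const _).add (((hm i).mul hexp).mul_const _)⟩
  refine key.congr' ?_
  filter_upwards [Filter.eventually_ge_atTop 0] with t ht
  rw [← (h.output_eq hδ ha ht i).1, ← (h.output_eq hδ ha ht i).2,
    expDQ_output ⟨isUnitDQ_center (h.unit i t ht) (hδ i), h.center_fst_ne hδ ha ht i⟩,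
    center_mul (hδ i)]

/-- Without a directed spanning tree there are motions in which two of the centers stay at rest at
different places. -/
theorem exists_isClosedLoop_of_not_hasDirectedSpanningTree [Nonempty (Fin n)]
    {G : WeightedDigraph n} {δ : Fin n → DualQuat} (hδ : ∀ i, IsUnitDQ (δ i))
    (hG : ¬ HasDirectedSpanningTree G.toDigraph) :
    ∃ x ξ : Fin n → ℝ → DualQuat, IsClosedLoop G δ x ξ ∧ IsAdmissible δ (fun i => x i 0) ∧
      ∃ (i j : Fin n) (b : ℍ[ℝ]), b ≠ 0 ∧ b.re = 0 ∧
        ∀ t, 0 ≤ t → x i t = expDQ 0 0 * δ i ∧ x j t = expDQ 0 b * δ j := by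
  classical
  obtain ⟨S, T, ⟨i, hi⟩, ⟨j, hj⟩, hST, hS, hT⟩ := exists_disjoint_of_not_hasDirectedSpanningTree hG
  have hclosed : ∀ {U : Set (Fin n)}, (∀ u v, G.Adj u v → v ∈ U → u ∈ U) →
      ∀ k ∈ U, ∀ l ∉ U, G.A k l = 0 := fun hU k hk l hl =>
    G.A_zero k l fun hadj => hl (hU l k hadj hk)
  set b : ℍ[ℝ] := ⟨0, 1, 0, 0⟩ with hb
  have hb0 : b ≠ 0 := fun h => one_ne_zero (congrArg (fun q : ℍ[ℝ] => q.imI) h)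
  -- Agents in `S` are influenced only by agents in `S`, where `d` is `0` by disjointness; agents in
  -- `T` average the constant `b`. All rotations are trivial.
  set d : Fin n → ℍ[ℝ] := fun k => if k ∈ T then b else 0 with hd
  have hdre : ∀ k, (d k).re = 0 := fun k => by
    by_cases h : k ∈ T <;> simp [hd, h, hb]
  have hzero : ∀ k t, linearOutput G (fun _ => 0) k t = 0 := fun k t => by simp [linearOutput]
  obtain ⟨ξ, hξ, -⟩ := exists_isClosedLoop G hδ (c := fun _ => 0) (d := d) (fun _ => rfl) hdre
    fun _ => by simpa using Real.pi_pos
  refine ⟨_, ξ, hξ, fun k => ⟨hξ.unit k 0 le_rfl,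
    isUnitDQ_center (hξ.unit k 0 le_rfl) (hδ k), ?_⟩, i, j, b, hb0, rfl, fun t ht => ⟨?_, ?_⟩⟩
  · simp only [rotation, center_mul_right (hδ k), hzero, expDQ, fst_mkDQ]
    exact exp_ne_neg_one rfl (by simpa using Real.pi_pos)
  · have h0 : linearOutput G d i t = 0 := Finset.sum_eq_zero fun k _ => by
      by_cases hk : k ∈ T
      · rw [consensusFlow_eq_zero (hclosed hS) t hi (Set.disjoint_right.1 hST hk), zero_smul]
      · simp [hd, hk]
    simp only [hzero, h0]
  · have h1 : linearOutput G d j t = b := by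
      have : ∀ k, consensusFlow G.A t j k • d k = consensusFlow G.A t j k • b := fun k => by
        by_cases hk : k ∈ T
        · simp [hd, hk]
        · rw [consensusFlow_eq_zero (hclosed hT) t hj hk, zero_smul, zero_smul]
      rw [linearOutput, Finset.sum_congr rfl fun k _ => this k, ← Finset.sum_smul,
        sum_consensusFlow G.A ht j, one_smul]
    simp only [hzero, h1]

theorem hasDirectedSpanningTree_of_achievesOutputConsensus [Nonempty (Fin n)]
    {G : WeightedDigraph n} {δ : Fin n → DualQuat} (hδ : ∀ i, IsUnitDQ (δ i))
    (h : AchievesOutputConsensus G δ) : HasDirectedSpanningTree G.toDigraph := by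
  by_contra hG
  obtain ⟨x, ξ, hx, ha, i, j, b, hb, -, hij⟩ :=
    exists_isClosedLoop_of_not_hasDirectedSpanningTree hδ hG
  have h1 := (tendsto_dq_iff.1 (h x ξ hx ha j i)).2
  refine hb (tendsto_nhds_unique (tendsto_const_nhds.congr' ?_) h1)
  filter_upwards [Filter.eventually_ge_atTop 0] with t ht
  rw [(hij t ht).1, (hij t ht).2, TrivSqZeroExt.snd_sub, output_expDQ_snd (hδ j) rfl,
    output_expDQ_snd (hδ i) rfl, sub_zero]

theorem hasDirectedSpanningTree_of_achievesFormation [Nonempty (Fin n)]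
    {G : WeightedDigraph n} {δ : Fin n → DualQuat} (hδ : ∀ i, IsUnitDQ (δ i))
    (h : AchievesFormation G δ) : HasDirectedSpanningTree G.toDigraph := by
  by_contra hG
  obtain ⟨x, ξ, hx, ha, i, j, b, hb, -, hij⟩ :=
    exists_isClosedLoop_of_not_hasDirectedSpanningTree hδ hG
  obtain ⟨xc, -, hlim⟩ := h x ξ hx ha
  -- An agent at rest determines the common center, since `δ k` cancels on the right; the two
  -- resting agents would force `b = 0`.
  have huniq : ∀ (k : Fin n) (y : ℍ[ℝ]), (∀ t, 0 ≤ t → x k t = expDQ 0 y * δ k) →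
      xc = expDQ 0 y := by
    intro k y hk
    have h1 : xc * δ k = expDQ 0 y * δ k := by
      have h2 := tendsto_dq_iff.1 (hlim k)
      have h3 : Filter.Tendsto (x k) Filter.atTop (𝓝 (expDQ 0 y * δ k)) := by
        refine tendsto_const_nhds.congr' ?_
        filter_upwards [Filter.eventually_ge_atTop 0] with t ht
        exact (hk t ht).symm
      have h4 := tendsto_dq_iff.1 h3
      exact dq_ext (tendsto_nhds_unique h2.1 h4.1) (tendsto_nhds_unique h2.2 h4.2)
    have h5 := congrArg (· * conj (δ k)) h1
    have h6 : δ k * conj (δ k) = 1 := hδ k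
    simpa only [mul_assoc, h6, mul_one] using h5
  have h1 := huniq i 0 fun t ht => (hij t ht).1
  rw [huniq j b fun t ht => (hij t ht).2] at h1
  have h2 := congrArg TrivSqZeroExt.snd h1
  simp only [expDQ, snd_mkDQ, NormedSpace.exp_zero, mul_one] at h2
  exact hb h2

end PoseFormation

end


theorem mainTheorem7 (n : ℕ) (hn : 1 ≤ n) (G : PoseFormation.WeightedDigraph n)
    (δ : Fin n → PoseFormation.DualQuat) (hδ : ∀ i, PoseFormation.IsUnitDQ (δ i)) :
    (∀ x₀ : Fin n → PoseFormation.DualQuat, PoseFormation.IsAdmissible δ x₀ →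
      ∃ x ξ : Fin n → ℝ → PoseFormation.DualQuat, PoseFormation.IsClosedLoop G δ x ξ ∧
        (∀ i t, 0 ≤ t → PoseFormation.IsPureDQ (ξ i t)) ∧ ∀ i, x i 0 = x₀ i) ∧
    (PoseFormation.AchievesOutputConsensus G δ ↔
      PoseFormation.HasDirectedSpanningTree G.toDigraph) ∧
    (PoseFormation.AchievesFormation G δ ↔
      PoseFormation.HasDirectedSpanningTree G.toDigraph) := by
  -- Without agents consensus and formation would hold trivially, whereas a spanning tree needs a
  -- root.
  have hne : Nonempty (Fin n) := ⟨⟨0, hn⟩⟩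
  exact ⟨fun x₀ h => PoseFormation.exists_isClosedLoop_of_isAdmissible G hδ h,
    ⟨PoseFormation.hasDirectedSpanningTree_of_achievesOutputConsensus hδ,
      PoseFormation.achievesOutputConsensus_of_hasDirectedSpanningTree hδ⟩,
    ⟨PoseFormation.hasDirectedSpanningTree_of_achievesFormation hδ,
      PoseFormation.achievesFormation_of_hasDirectedSpanningTree hδ⟩⟩
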